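/- Let $(\mathbb F,\|\cdot\|)$ be a complex Banach space, $q>1$ and $0<k_1<k_2$ real numbers. Let $\varsigma\ge 2$ be an integer, let indices be taken modulo $\varsigma$, and let $(\mathcal E_p)_{0\le p\le\varsigma-1}$ be a good covering in $\mathbb C^\star$ of radius $\epsilon_0>0$: each $\mathcal E_p$ is an open sector $\{se^{i\theta}: 0<s<\epsilon_0,\ |\theta-d_p|<\delta_p/2\}$ with $0<\delta_p\le 2\pi$, one has $\mathcal E_j\cap\mathcal E_k\ne\emptyset$ if and only if $j$ and $k$ are equal or cyclically consecutive, and $\bigcup_p\mathcal E_p=\mathcal U\setminus\{0\}$ for some neighbourhood $\mathcal U$ of the origin. For each $p$ let $G_p:\mathcal E_p\to\mathbb F$ be holomorphic and bounded as $\epsilon$ tends to $0$ in $\mathcal E_p$. Put $\Delta_p(\epsilon)=G_{p+1}(\epsilon)-G_p(\epsilon)$ for $\epsilon\in Z_p=\mathcal E_p\cap\mathcal E_{p+1}$. Suppose that $\{0,\dots,\varsigma-1\}$ is the disjoint union of two nonempty sets $I_1,I_2$ such that, for $j=1,2$ and every $p\in I_j$, there are $K>0$ and $M\in\mathbb R$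 with $$\|\Delta_p(\epsilon)\|\le K|\epsilon|^{M}\exp\Bigl(-\frac{k_j}{2\log q}\log^2|\epsilon|\Bigr),\qquad \epsilon\in Z_p.$$ Then there exist a power series $a(\epsilon)=\sum_{n\ge0}a_n\epsilon^n$ with coefficients in $\mathbb F$, convergent for $|\epsilon|<\epsilon_0$, formal power series $\hat G^1(\epsilon),\hat G^2(\epsilon)\in\mathbb F[[\epsilon]]$, and holomorphic functions $G_p^1,G_p^2:\mathcal E_p\to\mathbb F$ for every $p$, such that $$G_p(\epsilon)=a(\epsilon)+G_p^1(\epsilon)+G_p^2(\epsilon),\qquad \epsilon\in\mathcal E_p,\ 0\le p\le\varsigma-1,$$ and, for $j=1,2$ and every $0\le p\le\varsigma-1$, the function $G_p^j$ admits $\hat G^j$ as its $q$-Gevrey asymptotic expansion of order $1/k_j$ on $\mathcal E_p$. Here $f:V\to\mathbb F$ admits $\sum_{n\ge0}f_n\epsilon^n$ as its $q$-Gevrey asymptotic expansion of order $1/k$ on $V$ if for every open sector $U$ with vertex at $0$, finite radius and opening at most $2\pi$ such that $\overline U\setminus\{0\}\subseteq V$ there are $A,C>0$ with $$\Bigl\|f(\epsilon)-\sum_{n=0}^{N}f_n\epsilon^n\Bigr\|\le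 C A^{N+1}q^{\frac{N(N+1)}{2k}}|\epsilon|^{N+1},\qquad \epsilon\in U,\ N\ge0.$$ -/

import Mathlib

open Set Topology

noncomputable section

/-- The open bounded sector with vertex at the origin, bisecting direction `d`, opening `δ` and
radius `r`: the points `s * exp (i θ)` with `0 < s < r` and `|θ - d| < δ / 2`. -/
def openSector (d δ r : ℝ) : Set ℂ :=
  {z | ∃ s θ : ℝ, 0 < s ∧ s < r ∧ |θ - d| < δ / 2 ∧ z = (s : ℂ) * Complex.exp (θ * Complex.I)}

/-- `S` is an open sector of radius `r` with vertex at the origin of `ℂ`, of opening at most `2π`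
(so that it is contained in a slit disc). -/
def IsOpenSector (S : Set ℂ) (r : ℝ) : Prop :=
  0 < r ∧ ∃ d δ : ℝ, 0 < δ ∧ δ ≤ 2 * Real.pi ∧ S = openSector d δ r

/-- A good covering in `ℂ \ {0}` by `ς` open sectors of common radius `ε₀`. The indices are taken
modulo `ς`; two sectors meet exactly when their indices are equal or cyclically consecutive, and
the sectors fill up a punctured neighbourhood of the origin. -/
structure IsGoodCovering (ς : ℕ) (ε₀ : ℝ) (E : ZMod ς → Set ℂ) : Prop where
  two_le : 2 ≤ ς
  sector : ∀ p, IsOpenSector (E p) ε₀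
  inter_nonempty_iff : ∀ j k, (E j ∩ E k).Nonempty ↔ (k = j ∨ k = j + 1 ∨ j = k + 1)
  iUnion_eq : ∃ U ∈ 𝓝 (0 : ℂ), ⋃ p, E p = U \ {0}

/-- `f` is `q`-exponentially flat of order `k` on `Z`. -/
def IsQExpFlat {F : Type*} [NormedAddCommGroup F] (q k : ℝ) (Z : Set ℂ) (f : ℂ → F) : Prop :=
  ∃ K > (0 : ℝ), ∃ M : ℝ, ∀ ε ∈ Z,
    ‖f ε‖ ≤ K * ‖ε‖ ^ M * Real.exp (-(k / (2 * Real.log q)) * Real.log ‖ε‖ ^ 2)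

/-- `f` admits the formal power series `∑ cₙ εⁿ` as its `q`-Gevrey asymptotic expansion of order
`1 / k` on `V`: the estimates hold on every open sector `U` whose closure without the vertex is
contained in `V`, with constants that may depend on `U`. -/
def HasQGevreyExpansion {F : Type*} [NormedAddCommGroup F] [NormedSpace ℂ F]
    (q k : ℝ) (V : Set ℂ) (f : ℂ → F) (c : ℕ → F) : Prop :=
  ∀ (U : Set ℂ) (r : ℝ), IsOpenSector U r → closure U \ {0} ⊆ V →
    ∃ A > (0 : ℝ), ∃ C > (0 : ℝ), ∀ ε ∈ U, ∀ N : ℕ,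
      ‖f ε - ∑ n ∈ Finset.range (N + 1), ε ^ n • c n‖ ≤
        C * A ^ (N + 1) * q ^ ((N : ℝ) * ((N : ℝ) + 1) / (2 * k)) * ‖ε‖ ^ (N + 1)

end

/-!
# A two-level Ramis–Sibuya theorem for `q`-Gevrey asymptotics

The differences `G l - G j` form an additive cocycle on the covering, every member of which is
`q`-exponentially flat of order `k₁` or `k₂`. The proof splits this cocycle as `g₁ + g₂` with `gᵢ`
a cocycle that is flat of order `kᵢ` (`levelTwoCocycle` is `g₂`), and writes each `gᵢ` as a
coboundary of holomorphic functions that share a `q`-Gevrey expansion of order `1 / kᵢ`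
(`IsRadialCovering.exists_cocycle_solution`). Call these functions `Gᵢ p`. Then
`G p - G₁ p - G₂ p` does not depend on `p` and is bounded near the origin, so it extends to a
holomorphic function `a` on the disc (`IsRadialCovering.exists_differentiableOn_ball`), whose
Taylor series is the convergent part of the decomposition. When no three distinct sectors
have a common point, which is automatic for `ς ≠ 3`, the functions
`G₂ p` jump exactly across the intersections of level two.
For `ς = 2` the two differences are opposite and have the same domain, so that everything is of
level two.

The analytic core is the Cauchy–Heine transform `IsFlatOnStrip.exists_cauchyHeine`. If `D` is flat
on a sector, the Cauchy integral of `D` along a ray in the sector is holomorphic off the ray.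
Turning the ray within the sector continues the integral to a sector of opening more than `2π` on
the logarithmic surface, and by the residue theorem its two determinations differ by `D`.
Expanding the Cauchy kernel in a geometric series gives an asymptotic expansion whose coefficients
are the moments of `D`; completing the square in `exp (-n t - κ t²)` bounds them by
`C * A ^ n * q ^ (n * (n - 1) / (2 * k))` (`exp_flat_le`). As `D` need not be defined
beyond the radius `ε₀`, the ray cannot be turned as a whole: only its part of radius less than
`e ^ R` is turned, and an arc of radius `e ^ R` closes the path (`bentTransform`).

A cocycle on the covering is solved by cutting the circle into small arcs, each well inside one
sector (Lebesgue number), by adding the Cauchy–Heine transforms attached to the rays that separate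
the arcs, and by correcting with the cocycle itself. Since only the Lebesgue number of the
covering is used, the sectors may overlap in any way; in particular the intersection of two
sectors need not be connected.

Everything is written in the variable `u = log ε`: sectors become half strips, rays and arcs
become the edges of rectangles, and multivalued functions become functions.
-/

/-! ### Uniform `q`-Gevrey bounds -/

/-- The estimates of a `q`-Gevrey expansion of order `1 / k` with coefficients `c`, with constants
uniform on `S`. The variable of the expansion is `e x`, so that the same notion serves functions of
`ε` (with `e = id`) and functions of a logarithm of `ε` (with `e = Complex.exp`). -/
def QGevreyBoundOn {β F : Type*} [NormedAddCommGroup F] [NormedSpace ℂ F] (q k : ℝ) (e : β → ℂ)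
    (S : Set β) (f : β → F) (c : ℕ → F) : Prop :=
  ∃ A > (0 : ℝ), ∃ C > (0 : ℝ), ∀ x ∈ S, ∀ N : ℕ,
    ‖f x - ∑ n ∈ Finset.range (N + 1), e x ^ n • c n‖ ≤
      C * A ^ (N + 1) * q ^ ((N : ℝ) * ((N : ℝ) + 1) / (2 * k)) * ‖e x‖ ^ (N + 1)

section QGevreyBoundOn

variable {β γ F : Type*} [NormedAddCommGroup F] [NormedSpace ℂ F] {q k : ℝ} {e : β → ℂ}
  {S S' : Set β} {f g : β → F} {c d : ℕ → F}

lemma QGevreyBoundOn.mono (h : QGevreyBoundOn q k e S f c) (hS : S' ⊆ S) :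
    QGevreyBoundOn q k e S' f c := by
  obtain ⟨A, hA, C, hC, H⟩ := h
  exact ⟨A, hA, C, hC, fun x hx N => H x (hS hx) N⟩

lemma QGevreyBoundOn.congr (h : QGevreyBoundOn q k e S f c) (hfg : ∀ x ∈ S, f x = g x) :
    QGevreyBoundOn q k e S g c := by
  obtain ⟨A, hA, C, hC, H⟩ := h
  exact ⟨A, hA, C, hC, fun x hx N => by rw [← hfg x hx]; exact H x hx N⟩

lemma QGevreyBoundOn.comp {e' : γ → ℂ} {T : Set γ} (φ : γ → β)
    (h : QGevreyBoundOn q k e S f c) (hφ : MapsTo φ T S) (he : ∀ y ∈ T, e (φ y) = e' y) :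
    QGevreyBoundOn q k e' T (fun y => f (φ y)) c := by
  obtain ⟨A, hA, C, hC, H⟩ := h
  exact ⟨A, hA, C, hC, fun y hy N => by rw [← he y hy]; exact H _ (hφ hy) N⟩

lemma QGevreyBoundOn.zero (hq : 1 < q) :
    QGevreyBoundOn q k e S (fun _ => (0 : F)) (fun _ => 0) := by
  refine ⟨1, one_pos, 1, one_pos, fun x _ N => ?_⟩
  have : 0 < q := by linarith
  simp only [smul_zero, Finset.sum_const_zero, sub_zero, norm_zero]
  positivity

lemma QGevreyBoundOn.add (hq : 1 < q) (hf : QGevreyBoundOn q k e S f c)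
    (hg : QGevreyBoundOn q k e S g d) :
    QGevreyBoundOn q k e S (fun x => f x + g x) (fun n => c n + d n) := by
  obtain ⟨A, hA, C, hC, H⟩ := hf
  obtain ⟨A', hA', C', hC', H'⟩ := hg
  have hq0 : 0 < q := by linarith
  refine ⟨max A A', lt_max_of_lt_left hA, C + C', by positivity, fun x hx N => ?_⟩
  have e1 : f x + g x - ∑ n ∈ Finset.range (N + 1), e x ^ n • (c n + d n) =
      (f x - ∑ n ∈ Finset.range (N + 1), e x ^ n • c n) +
      (g x - ∑ n ∈ Finset.range (N + 1), e x ^ n • d n) := by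
    simp only [smul_add, Finset.sum_add_distrib]; abel
  rw [e1]
  refine (norm_add_le _ _).trans ((add_le_add (H x hx N) (H' x hx N)).trans ?_)
  rw [add_mul, add_mul, add_mul]
  gcongr
  · exact le_max_left _ _
  · exact le_max_right _ _

lemma QGevreyBoundOn.const_smul (hq : 1 < q) (z : ℂ) (hf : QGevreyBoundOn q k e S f c) :
    QGevreyBoundOn q k e S (fun x => z • f x) (fun n => z • c n) := by
  obtain ⟨A, hA, C, hC, H⟩ := hf
  have hq0 : 0 < q := by linarith
  refine ⟨A, hA, (‖z‖ + 1) * C, by positivity, fun x hx N => ?_⟩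
  have e1 : z • f x - ∑ n ∈ Finset.range (N + 1), e x ^ n • z • c n =
      z • (f x - ∑ n ∈ Finset.range (N + 1), e x ^ n • c n) := by
    simp only [smul_sub, Finset.smul_sum, smul_comm z]
  rw [e1, norm_smul]
  calc _ ≤ (‖z‖ + 1) * (C * A ^ (N + 1) * q ^ ((N : ℝ) * ((N : ℝ) + 1) / (2 * k)) *
        ‖e x‖ ^ (N + 1)) := by
        gcongr
        · linarith
        · exact H x hx N
    _ = _ := by ring

lemma QGevreyBoundOn.sum (hq : 1 < q) {ι : Type*} (s : Finset ι) {f : ι → β → F} {c : ι → ℕ → F}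
    (h : ∀ i ∈ s, QGevreyBoundOn q k e S (f i) (c i)) :
    QGevreyBoundOn q k e S (fun x => ∑ i ∈ s, f i x) (fun n => ∑ i ∈ s, c i n) := by
  classical
  induction s using Finset.induction_on with
  | empty => simpa using QGevreyBoundOn.zero hq
  | insert a s ha ih =>
    simp only [Finset.sum_insert ha]
    exact (h a (Finset.mem_insert_self _ _)).add hq
      (ih fun i hi => h i (Finset.mem_insert_of_mem hi))

lemma QGevreyBoundOn.union (hq : 1 < q) (h : QGevreyBoundOn q k e S f c)
    (h' : QGevreyBoundOn q k e S' f c) : QGevreyBoundOn q k e (S ∪ S') f c := by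
  obtain ⟨A, hA, C, hC, H⟩ := h
  obtain ⟨A', hA', C', hC', H'⟩ := h'
  have hq0 : 0 < q := by linarith
  refine ⟨max A A', lt_max_of_lt_left hA, max C C', lt_max_of_lt_left hC, fun x hx N => ?_⟩
  rcases hx with hx | hx
  · refine (H x hx N).trans ?_
    gcongr
    · exact le_max_left _ _
    · exact le_max_left _ _
  · refine (H' x hx N).trans ?_
    gcongr
    · exact le_max_right _ _
    · exact le_max_right _ _

lemma QGevreyBoundOn.biUnion (hq : 1 < q) {ι : Type*} (s : Finset ι) {S : ι → Set β}
    (h : ∀ i ∈ s, QGevreyBoundOn q k e (S i) f c) :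
    QGevreyBoundOn q k e (⋃ i ∈ s, S i) f c := by
  classical
  induction s using Finset.induction_on with
  | empty => exact ⟨1, one_pos, 1, one_pos, by simp⟩
  | insert a s ha ih =>
    rw [Finset.set_biUnion_insert]
    exact (h a (Finset.mem_insert_self _ _)).union hq
      (ih fun i hi => h i (Finset.mem_insert_of_mem hi))

end QGevreyBoundOn

/-- The coefficient `κ` of `log² |ε|` in the definition of `q`-exponential flatness of
order `k`. -/
noncomputable def flatRate (q k : ℝ) : ℝ := k / (2 * Real.log q)

lemma flatRate_pos {q k : ℝ} (hq : 1 < q) (hk : 0 < k) : 0 < flatRate q k :=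
  div_pos hk (mul_pos two_pos (Real.log_pos hq))

/-- Completing the square in the exponent `(M - n) t - κ t²` gives the maximum
`(n - M)² / (4 κ) = (n - M)² log q / (2 k)`: this is where the growth `q ^ (n (n - 1) / (2 k))`
comes from. -/
lemma exp_flat_le {q k : ℝ} (hq : 1 < q) (hk : 0 < k) (M : ℝ) : ∃ A > (0 : ℝ), ∃ C > (0 : ℝ),
    ∀ (n : ℕ) (t : ℝ), Real.exp ((M - n) * t - flatRate q k * t ^ 2) ≤
      C * A ^ n * q ^ ((n : ℝ) * ((n : ℝ) - 1) / (2 * k)) := by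
  have hq0 : 0 < q := by linarith
  refine ⟨q ^ ((1 - 2 * M) / (2 * k)), by positivity, q ^ (M ^ 2 / (2 * k)), by positivity,
    fun n t => ?_⟩
  rw [← Real.rpow_natCast (q ^ ((1 - 2 * M) / (2 * k))) n, ← Real.rpow_mul hq0.le,
    ← Real.rpow_add hq0, ← Real.rpow_add hq0, Real.rpow_def_of_pos hq0, Real.exp_le_exp]
  have hl := Real.log_pos hq
  have key : Real.log q * (M ^ 2 / (2 * k) + (1 - 2 * M) / (2 * k) * n +
      (n : ℝ) * ((n : ℝ) - 1) / (2 * k)) - ((M - n) * t - flatRate q k * t ^ 2) =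
      flatRate q k * (t - (M - n) / (2 * flatRate q k)) ^ 2 := by
    unfold flatRate
    field_simp
    ring
  have := mul_nonneg (flatRate_pos hq hk).le (sq_nonneg (t - (M - n) / (2 * flatRate q k)))
  linarith

/-- A flat function has the zero series as its expansion. -/
lemma QGevreyBoundOn.of_flat {β F : Type*} [NormedAddCommGroup F] [NormedSpace ℂ F] {q k : ℝ}
    (hq : 1 < q) (hk : 0 < k) {e : β → ℂ} {S : Set β} {f : β → F} {K M : ℝ}
    (he : ∀ x ∈ S, e x ≠ 0)
    (h : ∀ x ∈ S, ‖f x‖ ≤ K * Real.exp (M * Real.log ‖e x‖ - flatRate q k * Real.log ‖e x‖ ^ 2)) :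
    QGevreyBoundOn q k e S f (fun _ => 0) := by
  have hq0 : 0 < q := by linarith
  obtain ⟨A, hA, C, hC, H⟩ := exp_flat_le hq hk M
  refine ⟨A, hA, (|K| + 1) * C, by positivity, fun x hx N => ?_⟩
  have hx0 : 0 < ‖e x‖ := norm_pos_iff.2 (he x hx)
  simp only [smul_zero, Finset.sum_const_zero, sub_zero]
  have hn := H (N + 1) (Real.log ‖e x‖)
  have e1 : Real.exp (M * Real.log ‖e x‖ - flatRate q k * Real.log ‖e x‖ ^ 2) =
      Real.exp ((M - (N + 1 : ℕ)) * Real.log ‖e x‖ - flatRate q k * Real.log ‖e x‖ ^ 2) *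
        ‖e x‖ ^ (N + 1) := by
    conv_rhs => rw [← Real.exp_log (pow_pos hx0 (N + 1)), ← Real.exp_add, Real.log_pow]
    congr 1; ring
  calc ‖f x‖ ≤ _ := h x hx
    _ ≤ (|K| + 1) * (C * A ^ (N + 1) * q ^ (((N + 1 : ℕ) : ℝ) * (((N + 1 : ℕ) : ℝ) - 1) / (2 * k))
        * ‖e x‖ ^ (N + 1)) := by
        rw [e1]
        gcongr
        linarith [le_abs_self K]
    _ = _ := by
        rw [show ((N + 1 : ℕ) : ℝ) * (((N + 1 : ℕ) : ℝ) - 1) = (N : ℝ) * ((N : ℝ) + 1) by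
          push_cast; ring]
        ring

/-! ### Cauchy-type integrals in the logarithmic variable -/

section KernelIntegral

open MeasureTheory

variable {F : Type*} [NormedAddCommGroup F] [NormedSpace ℂ F]

/-- The Cauchy-type integral `∫ φ / (1 - e^{u - w})` along a parametrized path `w`. With `ε = e^u`
and `ξ = e^w` the kernel is `dξ / (ξ - ε)` written in the logarithmic variables. -/
noncomputable def kernelIntegral (μ : Measure ℝ) (w : ℝ → ℂ) (φ : ℝ → F) (u : ℂ) : F :=
  ∫ x, (1 - Complex.exp (u - w x))⁻¹ • φ x ∂μ

/-- A density along the path `w` that is `q`-exponentially flat of order `k` where `Re w → -∞`, up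
to an integrable factor `ψ`. -/
structure IsFlatDensity (q k : ℝ) (μ : Measure ℝ) (w : ℝ → ℂ) (φ : ℝ → F) : Prop where
  measurable : Measurable w
  aestronglyMeasurable : AEStronglyMeasurable φ μ
  bound : ∃ (ψ : ℝ → ℝ) (M : ℝ), Integrable ψ μ ∧
    ∀ᵐ x ∂μ, ‖φ x‖ ≤ ψ x * Real.exp (M * (w x).re - flatRate q k * (w x).re ^ 2)

variable {q k : ℝ} {μ : Measure ℝ} {w : ℝ → ℂ} {φ : ℝ → F}

/-- The moments of a flat density grow at most like `q ^ (n (n - 1) / (2 k))`. -/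
lemma IsFlatDensity.moment (hq : 1 < q) (hk : 0 < k) (h : IsFlatDensity q k μ w φ) :
    (∀ n : ℕ, Integrable (fun x => Complex.exp (-(n * w x)) • φ x) μ) ∧
    ∃ A > (0 : ℝ), ∃ C > (0 : ℝ), ∀ n : ℕ, ∫ x, ‖Complex.exp (-(n * w x)) • φ x‖ ∂μ ≤
      C * A ^ n * q ^ ((n : ℝ) * ((n : ℝ) - 1) / (2 * k)) := by
  have hq0 : 0 < q := by linarith
  obtain ⟨ψ, M, hψ, hb⟩ := h.bound
  obtain ⟨A, hA, C, hC, H⟩ := exp_flat_le hq hk M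
  have hmeas (n : ℕ) : AEStronglyMeasurable (fun x => Complex.exp (-(n * w x)) • φ x) μ := by
    refine AEStronglyMeasurable.smul ?_ h.aestronglyMeasurable
    have := h.measurable
    exact (by fun_prop : Measurable fun x => Complex.exp (-(n * w x))).aestronglyMeasurable
  have hle (n : ℕ) : ∀ᵐ x ∂μ, ‖Complex.exp (-(n * w x)) • φ x‖ ≤
      ψ x * (C * A ^ n * q ^ ((n : ℝ) * ((n : ℝ) - 1) / (2 * k))) := by
    filter_upwards [hb] with x hx
    have hψ0 : 0 ≤ ψ x := by
      by_contra! hneg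
      have := mul_neg_of_neg_of_pos hneg (Real.exp_pos (M * (w x).re - flatRate q k * (w x).re ^ 2))
      linarith [norm_nonneg (φ x)]
    rw [norm_smul, Complex.norm_exp]
    calc _ ≤ Real.exp (-(n * w x)).re *
          (ψ x * Real.exp (M * (w x).re - flatRate q k * (w x).re ^ 2)) := by gcongr
      _ = ψ x * Real.exp ((M - n) * (w x).re - flatRate q k * (w x).re ^ 2) := by
          rw [mul_left_comm, ← Real.exp_add]
          congr 2
          simp
          ring
      _ ≤ _ := by gcongr; exact H n _
  have hint (n : ℕ) : Integrable (fun x => Complex.exp (-(n * w x)) • φ x) μ :=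
    (hψ.mul_const _).mono' (hmeas n) (hle n)
  refine ⟨hint, A, hA, C * (|∫ x, ψ x ∂μ| + 1), by positivity, fun n => ?_⟩
  calc _ ≤ ∫ x, ψ x * (C * A ^ n * q ^ ((n : ℝ) * ((n : ℝ) - 1) / (2 * k))) ∂μ :=
        integral_mono_ae (hint n).norm (hψ.mul_const _) (hle n)
    _ = (∫ x, ψ x ∂μ) * (C * A ^ n * q ^ ((n : ℝ) * ((n : ℝ) - 1) / (2 * k))) :=
        integral_mul_const _ _
    _ ≤ (|∫ x, ψ x ∂μ| + 1) * (C * A ^ n * q ^ ((n : ℝ) * ((n : ℝ) - 1) / (2 * k))) := by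
        gcongr
        linarith [le_abs_self (∫ x, ψ x ∂μ)]
    _ = _ := by ring

lemma IsFlatDensity.integrable (hq : 1 < q) (hk : 0 < k) (h : IsFlatDensity q k μ w φ) :
    Integrable φ μ := by
  simpa using (h.moment hq hk).1 0

lemma aestronglyMeasurable_kernel (hw : Measurable w) (hφ : AEStronglyMeasurable φ μ) (u : ℂ) :
    AEStronglyMeasurable (fun x => (1 - Complex.exp (u - w x))⁻¹ • φ x) μ := by
  refine AEStronglyMeasurable.smul ?_ hφ
  exact (by fun_prop : Measurable fun x => (1 - Complex.exp (u - w x))⁻¹).aestronglyMeasurable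

lemma integrable_kernel (hw : Measurable w) (hφ : Integrable φ μ) {u : ℂ} {m : ℝ} (hm : 0 < m)
    (hu : ∀ᵐ x ∂μ, m ≤ ‖1 - Complex.exp (u - w x)‖) :
    Integrable (fun x => (1 - Complex.exp (u - w x))⁻¹ • φ x) μ := by
  refine (hφ.norm.const_mul m⁻¹).mono' (aestronglyMeasurable_kernel hw hφ.1 u) ?_
  filter_upwards [hu] with x hx
  rw [norm_smul, norm_inv]
  gcongr

/-- The Cauchy-type integral is holomorphic off the path. -/
lemma differentiableOn_kernelIntegral (hw : Measurable w) (hφ : Integrable φ μ) {V : Set ℂ}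
    (hV : IsOpen V) {m : ℝ} (hm : 0 < m)
    (hu : ∀ᵐ x ∂μ, ∀ u ∈ V, m ≤ ‖1 - Complex.exp (u - w x)‖) :
    DifferentiableOn ℂ (kernelIntegral μ w φ) V := by
  intro u₀ hu₀
  have hmeas : AEStronglyMeasurable (fun x => (Complex.exp (u₀ - w x) *
      ((1 - Complex.exp (u₀ - w x)) ^ 2)⁻¹) • φ x) μ := by
    refine AEStronglyMeasurable.smul ?_ hφ.1
    exact (by fun_prop : Measurable fun x => Complex.exp (u₀ - w x) *
      ((1 - Complex.exp (u₀ - w x)) ^ 2)⁻¹).aestronglyMeasurable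
  have := hasDerivAt_integral_of_dominated_loc_of_deriv_le
    (F := fun u x => (1 - Complex.exp (u - w x))⁻¹ • φ x)
    (F' := fun u x => (Complex.exp (u - w x) * ((1 - Complex.exp (u - w x)) ^ 2)⁻¹) • φ x)
    (bound := fun x => (m⁻¹ * m⁻¹ + m⁻¹) * ‖φ x‖) (hV.mem_nhds hu₀)
    (Filter.Eventually.of_forall fun u => aestronglyMeasurable_kernel hw hφ.1 u)
    (integrable_kernel hw hφ hm (hu.mono fun x hx => hx u₀ hu₀)) hmeas ?_
    (hφ.norm.const_mul _) ?_
  · exact this.2.differentiableAt.differentiableWithinAt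
  · filter_upwards [hu] with x hx u huV
    have h1 := hx u huV
    set z := Complex.exp (u - w x)
    have hz : 1 - z ≠ 0 := norm_pos_iff.1 (hm.trans_le h1)
    have e1 : z * ((1 - z) ^ 2)⁻¹ = (1 - z)⁻¹ * (1 - z)⁻¹ - (1 - z)⁻¹ := by
      field_simp
      ring
    rw [norm_smul, e1]
    gcongr
    refine (norm_sub_le _ _).trans ?_
    rw [norm_mul, norm_inv]
    gcongr
  · filter_upwards [hu] with x hx u huV
    have h1 := hx u huV
    have hz : 1 - Complex.exp (u - w x) ≠ 0 := norm_pos_iff.1 (hm.trans_le h1)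
    have hd : HasDerivAt (fun u => 1 - Complex.exp (u - w x)) (-Complex.exp (u - w x)) u := by
      simpa using (((hasDerivAt_id u).sub_const (w x)).cexp).const_sub 1
    have := (hd.inv hz).smul_const (φ x)
    exact this.congr_deriv (by rw [neg_neg, div_eq_mul_inv])

/-- Where the kernel is bounded below, the Cauchy-type integral of a flat density has the series
of its moments as a `q`-Gevrey expansion: this follows from
`1 / (1 - z) = ∑_{n ≤ N} z^n + z^{N + 1} / (1 - z)` with `z = e^{u - w}`. -/
lemma IsFlatDensity.qGevreyBoundOn (hq : 1 < q) (hk : 0 < k) (h : IsFlatDensity q k μ w φ)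
    {V : Set ℂ} {m : ℝ} (hm : 0 < m)
    (hu : ∀ u ∈ V, ∀ᵐ x ∂μ, m ≤ ‖1 - Complex.exp (u - w x)‖) :
    QGevreyBoundOn q k Complex.exp V (kernelIntegral μ w φ)
      (fun n => ∫ x, Complex.exp (-(n * w x)) • φ x ∂μ) := by
  have hq0 : 0 < q := by linarith
  obtain ⟨hint, A, hA, C, hC, H⟩ := h.moment hq hk
  refine ⟨A, hA, m⁻¹ * C, by positivity, fun u huV N => ?_⟩
  have e1 : kernelIntegral μ w φ u - ∑ n ∈ Finset.range (N + 1),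
      Complex.exp u ^ n • ∫ x, Complex.exp (-(n * w x)) • φ x ∂μ =
      ∫ x, ((1 - Complex.exp (u - w x))⁻¹ * Complex.exp u ^ (N + 1)) •
        (Complex.exp (-((N + 1 : ℕ) * w x)) • φ x) ∂μ := by
    have hi : ∀ n ∈ Finset.range (N + 1), Integrable
        (fun x => Complex.exp u ^ n • Complex.exp (-(n * w x)) • φ x) μ :=
      fun n _ => (hint n).smul _
    simp only [← integral_smul]
    rw [← integral_finsetSum _ hi, kernelIntegral,
      ← integral_sub (integrable_kernel h.measurable (h.integrable hq hk) hm (hu u huV))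
        (integrable_finsetSum _ hi)]
    refine integral_congr_ae ?_
    filter_upwards [hu u huV] with x hx
    have hz : 1 - Complex.exp (u - w x) ≠ 0 := norm_pos_iff.1 (hm.trans_le hx)
    have hpow (n : ℕ) : Complex.exp u ^ n * Complex.exp (-(n * w x)) =
        Complex.exp (u - w x) ^ n := by
      rw [← Complex.exp_nat_mul, ← Complex.exp_add, ← Complex.exp_nat_mul]
      congr 1; ring
    simp only [smul_smul, hpow, mul_assoc]
    rw [← Finset.sum_smul, ← sub_smul]
    congr 1
    have hg := geom_sum_mul (Complex.exp (u - w x)) (N + 1)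
    field_simp
    linear_combination hg
  rw [e1]
  calc _ ≤ ∫ x, m⁻¹ * ‖Complex.exp u‖ ^ (N + 1) *
        ‖Complex.exp (-((N + 1 : ℕ) * w x)) • φ x‖ ∂μ := by
        refine norm_integral_le_of_norm_le ((hint (N + 1)).norm.const_mul _) ?_
        filter_upwards [hu u huV] with x hx
        rw [norm_smul, norm_mul, norm_inv, norm_pow]
        gcongr
    _ ≤ m⁻¹ * ‖Complex.exp u‖ ^ (N + 1) * (C * A ^ (N + 1) *
        q ^ (((N + 1 : ℕ) : ℝ) * (((N + 1 : ℕ) : ℝ) - 1) / (2 * k))) := by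
        rw [integral_const_mul]
        gcongr
        exact H (N + 1)
    _ = _ := by
        rw [show ((N + 1 : ℕ) : ℝ) * (((N + 1 : ℕ) : ℝ) - 1) = (N : ℝ) * ((N : ℝ) + 1) by
          push_cast; ring]
        ring

end KernelIntegral

/-! ### Cauchy's formula on rectangles and half strips -/

section Rectangle

open MeasureTheory Complex Filter

variable {F : Type*} [NormedAddCommGroup F] [NormedSpace ℂ F]

/-- The counterclockwise integral of `f` along the boundary of the rectangle
`[x₀, x₁] × [a, b]`. -/
noncomputable def rectIntegral (f : ℂ → F) (x₀ x₁ a b : ℝ) : F :=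
  (∫ x : ℝ in x₀..x₁, f (x + a * I)) - (∫ x : ℝ in x₀..x₁, f (x + b * I)) +
    I • (∫ y : ℝ in a..b, f (x₁ + y * I)) - I • (∫ y : ℝ in a..b, f (x₀ + y * I))

lemma integral_inv_line_eq_log_sub {c d : ℂ} {s t : ℝ}
    (h : ∀ x ∈ uIcc s t, c + x * d ∈ slitPlane) :
    ∫ x : ℝ in s..t, d * (c + x * d)⁻¹ = log (c + t * d) - log (c + s * d) := by
  refine intervalIntegral.integral_eq_sub_of_hasDerivAt (f := fun x : ℝ => log (c + x * d))
    (fun x hx => ?_) ?_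
  · have h1 : HasDerivAt (fun x : ℝ => c + x * d) d x := by
      simpa using ((ofRealCLM.hasDerivAt (x := x)).mul_const d).const_add c
    have := h1.clog_real (h x hx)
    rwa [div_eq_mul_inv] at this
  · refine ContinuousOn.intervalIntegrable ?_
    refine continuousOn_const.mul (ContinuousOn.inv₀ (by fun_prop) fun x hx => ?_)
    exact slitPlane_ne_zero (h x hx)

lemma rectIntegral_inv_sub {x₀ x₁ a b : ℝ} {u : ℂ} (h₀ : x₀ < u.re) (h₁ : u.re < x₁)
    (ha : a < u.im) (hb : u.im < b) :
    rectIntegral (fun w => (w - u)⁻¹) x₀ x₁ a b = 2 * Real.pi * I := by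
  have hbot : ∫ x : ℝ in x₀..x₁, (x + a * I - u)⁻¹ =
      log (x₁ + a * I - u) - log (x₀ + a * I - u) := by
    have := integral_inv_line_eq_log_sub (c := a * I - u) (d := 1) (s := x₀) (t := x₁)
      fun x _ => Or.inr (by simp; linarith)
    simp only [one_mul, mul_one] at this
    convert this using 3 <;> ring_nf
  have htop : ∫ x : ℝ in x₀..x₁, (x + b * I - u)⁻¹ =
      log (x₁ + b * I - u) - log (x₀ + b * I - u) := by
    have := integral_inv_line_eq_log_sub (c := b * I - u) (d := 1) (s := x₀) (t := x₁)
      fun x _ => Or.inr (by simp; linarith)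
    simp only [one_mul, mul_one] at this
    convert this using 3 <;> ring_nf
  have hright : I * ∫ y : ℝ in a..b, (x₁ + y * I - u)⁻¹ =
      log (x₁ + b * I - u) - log (x₁ + a * I - u) := by
    have := integral_inv_line_eq_log_sub (c := x₁ - u) (d := I) (s := a) (t := b)
      fun x _ => Or.inl (by simp; linarith)
    rw [intervalIntegral.integral_const_mul] at this
    have e (y : ℝ) : (x₁ - u + y * I : ℂ) = x₁ + y * I - u := by ring
    simp only [e] at this
    exact this
  -- on the left edge the principal logarithm of `w - u` jumps, so `u - w` is used
  have hleft : I * ∫ y : ℝ in a..b, (x₀ + y * I - u)⁻¹ =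
      log (-(x₀ + b * I - u)) - log (-(x₀ + a * I - u)) := by
    have := integral_inv_line_eq_log_sub (c := u - x₀) (d := -I) (s := a) (t := b)
      fun x _ => Or.inl (by simp; linarith)
    rw [intervalIntegral.integral_const_mul] at this
    have e : ∀ y : ℝ, (u - x₀ + y * -I)⁻¹ = -(x₀ + y * I - u)⁻¹ := fun y => by
      rw [← inv_neg]; congr 1; ring
    simp only [e, intervalIntegral.integral_neg, neg_mul_neg] at this
    convert this using 3 <;> ring_nf
  have hlb : log (x₀ + b * I - u) - log (-(x₀ + b * I - u)) = Real.pi * I := by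
    have him : 0 < (x₀ + b * I - u : ℂ).im := by simp; linarith
    rw [log, log, arg_neg_eq_arg_sub_pi_of_im_pos him, norm_neg]
    push_cast; ring
  have hla : log (-(x₀ + a * I - u)) - log (x₀ + a * I - u) = Real.pi * I := by
    have him : (x₀ + a * I - u : ℂ).im < 0 := by simp; linarith
    rw [log, log, arg_neg_eq_arg_add_pi_of_im_neg him, norm_neg]
    push_cast; ring
  simp only [rectIntegral, smul_eq_mul]
  rw [hbot, htop, hright, hleft]
  linear_combination hlb + hla

/-- The boundary of a rectangle avoids its interior points. -/
lemma rect_edges {x₀ x₁ a b : ℝ} {u : ℂ} (h₀ : x₀ < u.re) (h₁ : u.re < x₁)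
    (ha : a < u.im) (hb : u.im < b) :
    (∀ x ∈ uIcc x₀ x₁, (x + a * I : ℂ) ∈ (uIcc x₀ x₁ ×ℂ uIcc a b) \ {u}) ∧
    (∀ x ∈ uIcc x₀ x₁, (x + b * I : ℂ) ∈ (uIcc x₀ x₁ ×ℂ uIcc a b) \ {u}) ∧
    (∀ y ∈ uIcc a b, (x₁ + y * I : ℂ) ∈ (uIcc x₀ x₁ ×ℂ uIcc a b) \ {u}) ∧
    (∀ y ∈ uIcc a b, (x₀ + y * I : ℂ) ∈ (uIcc x₀ x₁ ×ℂ uIcc a b) \ {u}) := by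
  refine ⟨fun x hx => ⟨?_, ?_⟩, fun x hx => ⟨?_, ?_⟩, fun x hx => ⟨?_, ?_⟩, fun x hx => ⟨?_, ?_⟩⟩
  · rw [mem_reProdIm]; simpa using hx
  · rintro rfl; simp at ha
  · rw [mem_reProdIm]; simpa using hx
  · rintro rfl; simp at hb
  · rw [mem_reProdIm]; simpa using hx
  · rintro rfl; simp at h₁
  · rw [mem_reProdIm]; simpa using hx
  · rintro rfl; simp at h₀

lemma rectIntegral_congr {f g : ℂ → F} {x₀ x₁ a b : ℝ} {u : ℂ} (h₀ : x₀ < u.re) (h₁ : u.re < x₁)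
    (ha : a < u.im) (hb : u.im < b) (h : ∀ w ∈ (uIcc x₀ x₁ ×ℂ uIcc a b) \ {u}, f w = g w) :
    rectIntegral f x₀ x₁ a b = rectIntegral g x₀ x₁ a b := by
  obtain ⟨e1, e2, e3, e4⟩ := rect_edges h₀ h₁ ha hb
  unfold rectIntegral
  rw [intervalIntegral.integral_congr fun x hx => h _ (e1 x hx),
    intervalIntegral.integral_congr fun x hx => h _ (e2 x hx),
    intervalIntegral.integral_congr fun x hx => h _ (e3 x hx),
    intervalIntegral.integral_congr fun x hx => h _ (e4 x hx)]

lemma rectIntegral_add {f g : ℂ → F} {x₀ x₁ a b : ℝ} {u : ℂ} (h₀ : x₀ < u.re) (h₁ : u.re < x₁)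
    (ha : a < u.im) (hb : u.im < b) (hf : ContinuousOn f ((uIcc x₀ x₁ ×ℂ uIcc a b) \ {u}))
    (hg : ContinuousOn g ((uIcc x₀ x₁ ×ℂ uIcc a b) \ {u})) :
    rectIntegral (fun w => f w + g w) x₀ x₁ a b =
      rectIntegral f x₀ x₁ a b + rectIntegral g x₀ x₁ a b := by
  obtain ⟨e1, e2, e3, e4⟩ := rect_edges h₀ h₁ ha hb
  have key (γ : ℝ → ℂ) (s t : ℝ) (hγ : Continuous γ)
      (hm : ∀ x ∈ uIcc s t, γ x ∈ (uIcc x₀ x₁ ×ℂ uIcc a b) \ {u}) :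
      ∫ x in s..t, (f (γ x) + g (γ x)) = (∫ x in s..t, f (γ x)) + ∫ x in s..t, g (γ x) :=
    intervalIntegral.integral_add (hf.comp hγ.continuousOn hm).intervalIntegrable
      (hg.comp hγ.continuousOn hm).intervalIntegrable
  have k1 := key (fun x => x + a * I) x₀ x₁ (by fun_prop) e1
  have k2 := key (fun x => x + b * I) x₀ x₁ (by fun_prop) e2
  have k3 := key (fun y => x₁ + y * I) a b (by fun_prop) e3
  have k4 := key (fun y => x₀ + y * I) a b (by fun_prop) e4
  simp only [rectIntegral]
  rw [k1, k2, k3, k4, smul_add, smul_add]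
  abel

lemma rectIntegral_smul_const [CompleteSpace F] (f : ℂ → ℂ) (v : F) (x₀ x₁ a b : ℝ) :
    rectIntegral (fun w => f w • v) x₀ x₁ a b = rectIntegral f x₀ x₁ a b • v := by
  simp only [rectIntegral, intervalIntegral.integral_smul_const, smul_eq_mul, sub_smul, add_smul,
    mul_smul]

lemma rectIntegral_eq_zero [CompleteSpace F] {f : ℂ → F} {x₀ x₁ a b : ℝ}
    (hf : DifferentiableOn ℂ f (uIcc x₀ x₁ ×ℂ uIcc a b)) : rectIntegral f x₀ x₁ a b = 0 := by
  have := integral_boundary_rect_eq_zero_of_differentiableOn f (x₀ + a * I) (x₁ + b * I)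
    (by simpa using hf)
  simpa [rectIntegral] using this

lemma rect_mem_nhds {x₀ x₁ a b : ℝ} {u : ℂ} (h₀ : x₀ < u.re) (h₁ : u.re < x₁)
    (ha : a < u.im) (hb : u.im < b) : uIcc x₀ x₁ ×ℂ uIcc a b ∈ 𝓝 u := by
  rw [uIcc_of_le (h₀.trans h₁).le, uIcc_of_le (ha.trans hb).le]
  exact Filter.inter_mem (continuous_re.continuousAt (Icc_mem_nhds h₀ h₁))
    (continuous_im.continuousAt (Icc_mem_nhds ha hb))

/-- Cauchy's integral formula on a rectangle. -/
lemma rectIntegral_inv_sub_smul [CompleteSpace F] {f : ℂ → F} {x₀ x₁ a b : ℝ} {u : ℂ}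
    (h₀ : x₀ < u.re) (h₁ : u.re < x₁) (ha : a < u.im) (hb : u.im < b)
    (hf : DifferentiableOn ℂ f (uIcc x₀ x₁ ×ℂ uIcc a b)) :
    rectIntegral (fun w => (w - u)⁻¹ • f w) x₀ x₁ a b = (2 * Real.pi * I) • f u := by
  have hd := (differentiableOn_dslope (rect_mem_nhds h₀ h₁ ha hb)).2 hf
  rw [rectIntegral_congr (g := fun w => dslope f u w + (w - u)⁻¹ • f u) h₀ h₁ ha hb,
    rectIntegral_add h₀ h₁ ha hb (hd.continuousOn.mono sdiff_subset), rectIntegral_eq_zero hd,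
    rectIntegral_smul_const, rectIntegral_inv_sub h₀ h₁ ha hb, zero_add]
  · refine ContinuousOn.smul (ContinuousOn.inv₀ (by fun_prop) fun w hw => ?_) continuousOn_const
    exact sub_ne_zero.2 hw.2
  · intro w hw
    rw [dslope_of_ne _ hw.2, slope_def_module, ← smul_add, sub_add_cancel]

/-- The kernel `1 / (1 - e^{u - w})` has a simple pole at `w = u` with residue `1`, and no other
pole in a rectangle of height less than `2π`. -/
lemma rectIntegral_kernel_smul [CompleteSpace F] {f : ℂ → F} {x₀ x₁ a b : ℝ} {u : ℂ}
    (h₀ : x₀ < u.re) (h₁ : u.re < x₁) (ha : a < u.im) (hb : u.im < b)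
    (hab : b - a < 2 * Real.pi) (hf : DifferentiableOn ℂ f (uIcc x₀ x₁ ×ℂ uIcc a b)) :
    rectIntegral (fun w => (1 - exp (u - w))⁻¹ • f w) x₀ x₁ a b = (2 * Real.pi * I) • f u := by
  set φ : ℂ → ℂ := fun w => 1 - exp (u - w) with hφ
  have hφd : Differentiable ℂ φ := by fun_prop
  have hφu : φ u = 0 := by simp [hφ]
  have hsd : DifferentiableOn ℂ (dslope φ u) univ :=
    (differentiableOn_dslope univ_mem).2 hφd.differentiableOn
  have hu1 : dslope φ u u = 1 := by
    rw [dslope_same]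
    have : HasDerivAt φ (-(exp (u - u) * -1)) u :=
      (((hasDerivAt_id u).const_sub u).cexp).const_sub 1
    simpa using this.deriv
  have hne : ∀ w ∈ uIcc x₀ x₁ ×ℂ uIcc a b, dslope φ u w ≠ 0 := by
    intro w hw
    by_cases hwu : w = u
    · rw [hwu, hu1]; exact one_ne_zero
    · rw [dslope_of_ne _ hwu, slope_def_field, hφu, sub_zero]
      refine div_ne_zero (fun h => hwu ?_) (sub_ne_zero.2 hwu)
      have h1 : exp (u - w) = 1 := (sub_eq_zero.1 h).symm
      obtain ⟨n, hn⟩ := exp_eq_one_iff.1 h1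
      have him : u.im - w.im = n * (2 * Real.pi) := by simpa using congrArg im hn
      rw [mem_reProdIm, uIcc_of_le (ha.trans hb).le] at hw
      have hpi := Real.pi_pos
      have hn1 : (n : ℝ) < 1 := by
        by_contra! hcon
        nlinarith [hw.2.1, hw.2.2]
      have hn2 : (-1 : ℝ) < n := by
        by_contra! hcon
        nlinarith [hw.2.1, hw.2.2]
      have hn0 : n = 0 := by
        have : n < 1 := by exact_mod_cast hn1
        have : -1 < n := by exact_mod_cast hn2
        omega
      rw [hn0] at hn
      simp only [Int.cast_zero, zero_mul] at hn
      exact (sub_eq_zero.1 hn).symm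
  have hΦ : DifferentiableOn ℂ (fun w => (dslope φ u w)⁻¹ • f w) (uIcc x₀ x₁ ×ℂ uIcc a b) :=
    ((hsd.mono (subset_univ _)).inv hne).smul hf
  have := rectIntegral_inv_sub_smul h₀ h₁ ha hb hΦ
  rw [hu1, inv_one, one_smul] at this
  rw [← this]
  refine rectIntegral_congr h₀ h₁ ha hb fun w hw => ?_
  rw [smul_smul, ← mul_inv, dslope_of_ne _ hw.2, slope_def_field, hφu, sub_zero,
    mul_div_cancel₀ _ (sub_ne_zero.2 hw.2)]

/-- Letting the left edge of a rectangle go to `-∞`. -/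
lemma halfStrip_integral_eq {f : ℂ → F} {R a b B : ℝ} {V : F} (hab : a ≤ b)
    (hfa : IntegrableOn (fun x : ℝ => f (x + a * I)) (Iic R))
    (hfb : IntegrableOn (fun x : ℝ => f (x + b * I)) (Iic R))
    (hrect : ∀ᶠ X in atBot, rectIntegral f X R a b = V)
    (hdecay : ∀ᶠ X : ℝ in atBot, ∀ y ∈ Icc a b, ‖f (X + y * I)‖ ≤ B * Real.exp X) :
    (∫ x : ℝ in Iic R, f (x + a * I)) + I • (∫ y : ℝ in a..b, f (R + y * I)) -
      (∫ x : ℝ in Iic R, f (x + b * I)) = V := by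
  have h1 := intervalIntegral_tendsto_integral_Iic R hfa tendsto_id
  have h2 := intervalIntegral_tendsto_integral_Iic R hfb tendsto_id
  have h3 : Tendsto (fun X : ℝ => ∫ y : ℝ in a..b, f (X + y * I)) atBot (𝓝 0) := by
    have hlim : Tendsto (fun X : ℝ => B * Real.exp X * |b - a|) atBot (𝓝 0) := by
      simpa using (Real.tendsto_exp_atBot.const_mul B).mul_const |b - a|
    refine squeeze_zero_norm' ?_ hlim
    filter_upwards [hdecay] with X hX
    refine intervalIntegral.norm_integral_le_of_norm_le_const fun y hy => hX y ?_
    rw [uIoc_of_le hab] at hy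
    exact ⟨hy.1.le, hy.2⟩
  have h4 : Tendsto (fun X => rectIntegral f X R a b) atBot (𝓝
      ((∫ x : ℝ in Iic R, f (x + a * I)) - (∫ x : ℝ in Iic R, f (x + b * I)) +
        I • (∫ y : ℝ in a..b, f (R + y * I)) - I • (0 : F))) :=
    ((h1.sub h2).add_const _).sub (h3.const_smul I)
  have h5 := tendsto_nhds_unique h4 (tendsto_const_nhds.congr' (hrect.mono fun X hX => hX.symm))
  rw [← h5, smul_zero]
  abel

end Rectangle

/-! ### The Cauchy–Heine transform -/

section CauchyHeine

open MeasureTheory Complex Filter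

/-- Lower bound for the kernel when `w` and `u` have different arguments. -/
lemma exists_le_norm_one_sub_exp_of_im {ζ : ℝ} (h0 : 0 < ζ) : ∃ m > (0 : ℝ),
    ∀ z : ℂ, ζ ≤ |z.im| → |z.im| ≤ 2 * Real.pi - ζ → m ≤ ‖1 - exp z‖ := by
  by_cases hπ : ζ ≤ Real.pi
  swap
  · exact ⟨1, one_pos, fun z h1 h2 => by linarith⟩
  have hcos : Real.cos ζ < 1 := by
    rw [← Real.cos_zero]
    exact Real.cos_lt_cos_of_nonneg_of_le_pi le_rfl hπ h0
  refine ⟨√((1 - Real.cos ζ) / 2), Real.sqrt_pos.2 (by linarith), fun z h1 h2 => ?_⟩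
  have hc : Real.cos z.im ≤ Real.cos ζ := by
    rw [← Real.cos_abs z.im]
    rcases le_total |z.im| Real.pi with h | h
    · exact Real.cos_le_cos_of_nonneg_of_le_pi h0.le h h1
    · rw [← Real.cos_two_pi_sub]
      exact Real.cos_le_cos_of_nonneg_of_le_pi h0.le (by linarith) (by linarith)
  refine Real.sqrt_le_iff.2 ⟨norm_nonneg _, ?_⟩
  rw [← normSq_eq_norm_sq, normSq_apply]
  simp only [sub_re, one_re, sub_im, one_im, exp_re, exp_im]
  have hr := Real.exp_pos z.re
  set r := Real.exp z.re
  have hsc := Real.sin_sq_add_cos_sq z.im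
  have hcl := Real.neg_one_le_cos z.im
  have e : (1 - r * Real.cos z.im) * (1 - r * Real.cos z.im) +
      (0 - r * Real.sin z.im) * (0 - r * Real.sin z.im) = 1 - 2 * r * Real.cos z.im + r ^ 2 := by
    linear_combination r ^ 2 * hsc
  rw [e]
  rcases le_total (Real.cos z.im) 0 with h | h <;>
    nlinarith [sq_nonneg (r - 1), mul_nonneg hr.le hr.le]

/-- Lower bound for the kernel when `|ξ| > |ε|`. -/
lemma le_norm_one_sub_exp_of_re {ζ : ℝ} {z : ℂ} (h : z.re ≤ -ζ) :
    1 - Real.exp (-ζ) ≤ ‖1 - exp z‖ := by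
  have h1 := norm_sub_norm_le (1 : ℂ) (exp z)
  rw [norm_one, norm_exp] at h1
  have := Real.exp_le_exp.2 h
  linarith

variable {F : Type*} [NormedAddCommGroup F] [NormedSpace ℂ F]

/-- `D` is holomorphic and `q`-exponentially flat of order `k` on the half strip
`Re w < L`, `α < Im w < β`, which is a sector of radius `e^L` in the variable `e^w`. -/
structure IsFlatOnStrip (q k L α β : ℝ) (D : ℂ → F) : Prop where
  differentiableOn : DifferentiableOn ℂ D {w | w.re < L ∧ α < w.im ∧ w.im < β}
  bound : ∃ K M : ℝ, ∀ w : ℂ, w.re < L → α < w.im → w.im < β →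
    ‖D w‖ ≤ K * Real.exp (M * w.re - flatRate q k * w.re ^ 2)

variable {q k L α β : ℝ} {D : ℂ → F}

lemma IsFlatOnStrip.ray (h : IsFlatOnStrip q k L α β D) {c : ℝ} (h1 : α < c) (h2 : c < β)
    {s : Set ℝ} (hs : MeasurableSet s) (hsL : s ⊆ Iio L) :
    IsFlatDensity q k (volume.restrict s) (fun x => x + c * I) (fun x => D (x + c * I)) := by
  obtain ⟨K, M, hb⟩ := h.bound
  refine ⟨by fun_prop, ?_, fun x => K * Real.exp x, M - 1, ?_, ?_⟩
  · refine ContinuousOn.aestronglyMeasurable ?_ hs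
    refine h.differentiableOn.continuousOn.comp (by fun_prop) fun x hx => ?_
    simpa [h1, h2] using hsL hx
  · exact ((integrableOn_exp_Iic L).mono_set (hsL.trans Iio_subset_Iic_self)).const_mul K
  · refine (ae_restrict_iff' hs).2 (ae_of_all _ fun x hx => ?_)
    have := hb (x + c * I) (by simpa using hsL hx) (by simpa using h1) (by simpa using h2)
    rw [mul_assoc, ← Real.exp_add]
    convert this using 3
    simp
    ring

lemma IsFlatOnStrip.arc (h : IsFlatOnStrip q k L α β D) {a b R : ℝ} (h1 : α < a) (h2 : b < β)
    (hR : R < L) :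
    IsFlatDensity q k (volume.restrict (Ioc a b)) (fun y => R + y * I)
      (fun y => I • D (R + y * I)) := by
  obtain ⟨K, M, hb⟩ := h.bound
  refine ⟨by fun_prop, ?_, fun x => K, M, ?_, ?_⟩
  · refine ContinuousOn.aestronglyMeasurable ?_ measurableSet_Ioc
    refine ContinuousOn.const_smul ?_ _
    refine h.differentiableOn.continuousOn.comp (by fun_prop) fun x hx => ?_
    simpa [hR] using And.intro (h1.trans hx.1) (hx.2.trans_lt h2)
  · exact integrableOn_const (by simp)
  · refine (ae_restrict_iff' measurableSet_Ioc).2 (ae_of_all _ fun y hy => ?_)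
    rw [norm_smul, norm_I, one_mul]
    exact hb (R + y * I) (by simpa using hR) (by simpa using h1.trans hy.1)
      (by simpa using hy.2.trans_lt h2)

/-- A flat function tends to zero faster than `|e^w|`, even after multiplication by a power of
`e^{-w}`. -/
lemma IsFlatOnStrip.exists_norm_le (hq : 1 < q) (hk : 0 < k) (h : IsFlatOnStrip q k L α β D)
    (n : ℕ) : ∃ B : ℝ, ∀ w : ℂ, w.re < L → α < w.im → w.im < β →
      ‖exp (-(n * w)) • D w‖ ≤ B * Real.exp w.re := by
  obtain ⟨K, M, hb⟩ := h.bound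
  obtain ⟨A, hA, C, hC, H⟩ := exp_flat_le hq hk (M - 1)
  have hq0 : 0 < q := by linarith
  refine ⟨|K| * (C * A ^ n * q ^ ((n : ℝ) * ((n : ℝ) - 1) / (2 * k))), fun w h1 h2 h3 => ?_⟩
  rw [norm_smul, norm_exp]
  have e : Real.exp (-(n * w)).re * Real.exp (M * w.re - flatRate q k * w.re ^ 2) =
      Real.exp ((M - 1 - n) * w.re - flatRate q k * w.re ^ 2) * Real.exp w.re := by
    rw [← Real.exp_add, ← Real.exp_add]
    congr 1
    simp
    ring
  calc _ ≤ Real.exp (-(n * w)).re * (|K| * Real.exp (M * w.re - flatRate q k * w.re ^ 2)) := by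
        gcongr
        exact (hb w h1 h2 h3).trans (by gcongr; exact le_abs_self K)
    _ = |K| * (Real.exp ((M - 1 - n) * w.re - flatRate q k * w.re ^ 2) * Real.exp w.re) := by
        rw [← e]; ring
    _ ≤ |K| * ((C * A ^ n * q ^ ((n : ℝ) * ((n : ℝ) - 1) / (2 * k))) * Real.exp w.re) := by
        gcongr; exact H n _
    _ = _ := by ring

/-- The Cauchy-type integral of `D` along the ray of argument `b`. -/
noncomputable def rayTransform (D : ℂ → F) (L b : ℝ) (u : ℂ) : F :=
  kernelIntegral (volume.restrict (Iio L)) (fun x => x + b * I) (fun x => D (x + b * I)) u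

/-- The Cauchy-type integral of `D` along the path that follows the ray of argument `a` up to
radius `e^R`, the arc of radius `e^R` up to the argument `b`, and then the ray of argument `b`. -/
noncomputable def bentTransform (D : ℂ → F) (L a b R : ℝ) (u : ℂ) : F :=
  kernelIntegral (volume.restrict (Iic R)) (fun x => x + a * I) (fun x => D (x + a * I)) u +
  kernelIntegral (volume.restrict (Ioc a b)) (fun y => R + y * I) (fun y => I • D (R + y * I)) u +
  kernelIntegral (volume.restrict (Ioo R L)) (fun x => x + b * I) (fun x => D (x + b * I)) u

/-- The moments of `D` along the ray of argument `b`. -/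
noncomputable def rayMoment (D : ℂ → F) (L b : ℝ) (n : ℕ) : F :=
  ∫ x in Iio L, exp (-(n * (x + b * I))) • D (x + b * I)

lemma rayTransform_add_two_pi (u : ℂ) (b : ℝ) :
    rayTransform D L b (u + 2 * Real.pi * I) = rayTransform D L b u := by
  have (w : ℂ) : exp (u + 2 * Real.pi * I - w) = exp (u - w) := by
    rw [add_sub_right_comm, exp_periodic]
  simp only [rayTransform, kernelIntegral, this]

lemma le_abs_im_sub_ray {b ζ x : ℝ} {u : ℂ} (h1 : b + ζ ≤ u.im)
    (h2 : u.im ≤ b + 2 * Real.pi - ζ) (hζ : 0 < ζ) :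
    ζ ≤ |(u - (x + b * I)).im| ∧ |(u - (x + b * I)).im| ≤ 2 * Real.pi - ζ := by
  have : (u - (x + b * I)).im = u.im - b := by simp
  rw [this, abs_of_nonneg (by linarith)]
  constructor <;> linarith

lemma IsFlatOnStrip.differentiableAt_rayTransform (hq : 1 < q) (hk : 0 < k)
    (h : IsFlatOnStrip q k L α β D) {b : ℝ} (h1 : α < b) (h2 : b < β) {u : ℂ} (hu1 : b < u.im)
    (hu2 : u.im < b + 2 * Real.pi) : DifferentiableAt ℂ (rayTransform D L b) u := by
  obtain ⟨ζ, hζ, hζ1⟩ := exists_between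
    (show (0 : ℝ) < min (u.im - b) (b + 2 * Real.pi - u.im) from lt_min (by linarith) (by linarith))
  rw [lt_min_iff] at hζ1
  obtain ⟨m, hm, H⟩ := exists_le_norm_one_sub_exp_of_im hζ
  have hV : IsOpen {v : ℂ | b + ζ < v.im ∧ v.im < b + 2 * Real.pi - ζ} :=
    (isOpen_lt continuous_const continuous_im).inter (isOpen_lt continuous_im continuous_const)
  refine (differentiableOn_kernelIntegral (by fun_prop)
    ((h.ray h1 h2 measurableSet_Iio subset_rfl).integrable hq hk) hV hm
    (ae_of_all _ fun x v hv => ?_)).differentiableAt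
    (hV.mem_nhds ⟨by linarith [hζ1.1], by linarith [hζ1.2]⟩)
  have := le_abs_im_sub_ray (x := x) hv.1.le hv.2.le hζ
  exact H _ this.1 this.2

lemma IsFlatOnStrip.differentiableAt_bentTransform (hq : 1 < q) (hk : 0 < k)
    (h : IsFlatOnStrip q k L α β D) {a b R : ℝ} (h1 : α < a) (hab : a < b) (h2 : b < β)
    (hR : R < L) {u : ℂ} (hu : u.re < R) (hu1 : a < u.im) (hu2 : u.im < a + 2 * Real.pi) :
    DifferentiableAt ℂ (bentTransform D L a b R) u := by
  obtain ⟨ζ, hζ, hζ1⟩ := exists_between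
    (show (0 : ℝ) < min (min (u.im - a) (a + 2 * Real.pi - u.im)) (R - u.re) from
      lt_min (lt_min (by linarith) (by linarith)) (by linarith))
  rw [lt_min_iff, lt_min_iff] at hζ1
  obtain ⟨m, hm, H⟩ := exists_le_norm_one_sub_exp_of_im hζ
  have hm' : 0 < 1 - Real.exp (-ζ) := by
    have := Real.exp_lt_one_iff.2 (show -ζ < 0 by linarith)
    linarith
  have hV : IsOpen {v : ℂ | (a + ζ < v.im ∧ v.im < a + 2 * Real.pi - ζ) ∧ v.re < R - ζ} :=
    ((isOpen_lt continuous_const continuous_im).inter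
      (isOpen_lt continuous_im continuous_const)).inter (isOpen_lt continuous_re continuous_const)
  have huV := hV.mem_nhds (x := u)
    ⟨⟨by linarith [hζ1.1.1], by linarith [hζ1.1.2]⟩, by linarith [hζ1.2]⟩
  refine DifferentiableAt.add (DifferentiableAt.add ?_ ?_) ?_
  · refine (differentiableOn_kernelIntegral (by fun_prop)
      ((h.ray h1 (hab.trans h2) measurableSet_Iic (Iic_subset_Iio.2 hR)).integrable hq hk) hV hm
      (ae_of_all _ fun x v hv => ?_)).differentiableAt huV
    have := le_abs_im_sub_ray (x := x) hv.1.1.le hv.1.2.le hζ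
    exact H _ this.1 this.2
  · refine (differentiableOn_kernelIntegral (by fun_prop)
      ((h.arc h1 h2 hR).integrable hq hk) hV hm'
      (ae_of_all _ fun x v hv => le_norm_one_sub_exp_of_re ?_)).differentiableAt huV
    simp only [sub_re, add_re, ofReal_re, mul_re, I_re, mul_zero, ofReal_im, I_im, mul_one,
      sub_self, add_zero]
    linarith [hv.2]
  · refine (differentiableOn_kernelIntegral (by fun_prop)
      ((h.ray (h1.trans hab) h2 measurableSet_Ioo Ioo_subset_Iio_self).integrable hq hk) hV hm'
      ((ae_restrict_iff' measurableSet_Ioo).2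
        (ae_of_all _ fun x hx v hv => le_norm_one_sub_exp_of_re ?_))).differentiableAt huV
    simp only [sub_re, add_re, ofReal_re, mul_re, I_re, mul_zero, ofReal_im, I_im, mul_one,
      sub_self, add_zero]
    linarith [hv.2, hx.1]

lemma IsFlatOnStrip.qGevreyBoundOn_rayTransform (hq : 1 < q) (hk : 0 < k)
    (h : IsFlatOnStrip q k L α β D) {b ζ : ℝ} (h1 : α < b) (h2 : b < β) (hζ : 0 < ζ) :
    QGevreyBoundOn q k exp {u | b + ζ ≤ u.im ∧ u.im ≤ b + 2 * Real.pi - ζ} (rayTransform D L b)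
      (rayMoment D L b) := by
  obtain ⟨m, hm, H⟩ := exists_le_norm_one_sub_exp_of_im hζ
  refine (h.ray h1 h2 measurableSet_Iio subset_rfl).qGevreyBoundOn hq hk hm
    fun v hv => ae_of_all _ fun x => ?_
  have := le_abs_im_sub_ray (x := x) hv.1 hv.2 hζ
  exact H _ this.1 this.2

/-- Cauchy's theorem shows that the bent path has the same moments as the ray. -/
lemma IsFlatOnStrip.bentMoment_eq [CompleteSpace F] (hq : 1 < q) (hk : 0 < k)
    (h : IsFlatOnStrip q k L α β D) {a b R : ℝ} (h1 : α < a) (hab : a < b) (h2 : b < β)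
    (hR : R < L) (n : ℕ) :
    (∫ x in Iic R, exp (-(n * (x + a * I))) • D (x + a * I)) +
      (∫ y in Ioc a b, exp (-(n * (R + y * I))) • I • D (R + y * I)) +
      (∫ x in Ioo R L, exp (-(n * (x + b * I))) • D (x + b * I)) = rayMoment D L b n := by
  have hia := ((h.ray h1 (hab.trans h2) measurableSet_Iic (Iic_subset_Iio.2 hR)).moment hq hk).1 n
  have hib := ((h.ray (h1.trans hab) h2 measurableSet_Iic (Iic_subset_Iio.2 hR)).moment hq hk).1 n
  have hib' := ((h.ray (h1.trans hab) h2 measurableSet_Ioo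
    (Ioo_subset_Iio_self (a := R))).moment hq hk).1 n
  obtain ⟨B, hB⟩ := h.exists_norm_le hq hk n
  have key := halfStrip_integral_eq (f := fun w => exp (-(n * w)) • D w) (R := R) (a := a) (b := b)
    (B := B) (V := 0) hab.le hia hib ?_ ?_
  · have e1 : Iio L = Iic R ∪ Ioo R L := (Iic_union_Ioo_eq_Iio hR).symm
    rw [rayMoment, e1, setIntegral_union (Iic_disjoint_Ioi le_rfl |>.mono_right Ioo_subset_Ioi_self)
      measurableSet_Ioo hib hib']
    rw [intervalIntegral.integral_of_le hab.le, ← integral_smul] at key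
    simp only [smul_comm I] at key
    rw [← sub_eq_zero, ← key]
    abel
  · filter_upwards [eventually_lt_atBot R] with X hX
    refine rectIntegral_eq_zero ?_
    refine DifferentiableOn.smul (by fun_prop) (h.differentiableOn.mono fun w hw => ?_)
    rw [mem_reProdIm, uIcc_of_le hX.le, uIcc_of_le hab.le] at hw
    exact ⟨hw.1.2.trans_lt hR, h1.trans_le hw.2.1, hw.2.2.trans_lt h2⟩
  · filter_upwards [eventually_lt_atBot L] with X hX y hy
    simpa using hB (X + y * I) (by simpa using hX) (by simpa using h1.trans_le hy.1)
      (by simpa using hy.2.trans_lt h2)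

lemma IsFlatOnStrip.qGevreyBoundOn_bentTransform [CompleteSpace F] (hq : 1 < q) (hk : 0 < k)
    (h : IsFlatOnStrip q k L α β D) {a b R ρ ζ : ℝ} (h1 : α < a) (hab : a < b) (h2 : b < β)
    (hR : R < L) (hρ : ρ < R) (hζ : 0 < ζ) :
    QGevreyBoundOn q k exp {u | u.re ≤ ρ ∧ a + ζ ≤ u.im ∧ u.im ≤ a + 2 * Real.pi - ζ}
      (bentTransform D L a b R) (rayMoment D L b) := by
  obtain ⟨m, hm, H⟩ := exists_le_norm_one_sub_exp_of_im hζ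
  have hm' : 0 < 1 - Real.exp (-(R - ρ)) := by
    have := Real.exp_lt_one_iff.2 (show -(R - ρ) < 0 by linarith)
    linarith
  rw [← funext fun n => h.bentMoment_eq hq hk h1 hab h2 hR n]
  refine QGevreyBoundOn.add hq (QGevreyBoundOn.add hq ?_ ?_) ?_
  · refine (h.ray h1 (hab.trans h2) measurableSet_Iic (Iic_subset_Iio.2 hR)).qGevreyBoundOn hq hk hm
      fun v hv => ae_of_all _ fun x => ?_
    have := le_abs_im_sub_ray (x := x) hv.2.1 hv.2.2 hζ
    exact H _ this.1 this.2
  · refine (h.arc h1 h2 hR).qGevreyBoundOn hq hk hm'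
      fun v hv => ae_of_all _ fun x => le_norm_one_sub_exp_of_re ?_
    simp only [sub_re, add_re, ofReal_re, mul_re, I_re, mul_zero, ofReal_im, I_im, mul_one,
      sub_self, add_zero]
    linarith [hv.1]
  · refine (h.ray (h1.trans hab) h2 measurableSet_Ioo Ioo_subset_Iio_self).qGevreyBoundOn hq hk hm'
      fun v hv => (ae_restrict_iff' measurableSet_Ioo).2
        (ae_of_all _ fun x hx => le_norm_one_sub_exp_of_re ?_)
    simp only [sub_re, add_re, ofReal_re, mul_re, I_re, mul_zero, ofReal_im, I_im, mul_one,
      sub_self, add_zero]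
    linarith [hv.1, hx.1]

end CauchyHeine

section CauchyHeineJump

open MeasureTheory Complex Filter

variable {F : Type*} [NormedAddCommGroup F] [NormedSpace ℂ F]
  {q k L α β : ℝ} {D : ℂ → F}

/-- The two transforms differ by the integral of the kernel along the boundary of a half strip. -/
lemma IsFlatOnStrip.bentTransform_sub_rayTransform (hq : 1 < q) (hk : 0 < k)
    (h : IsFlatOnStrip q k L α β D) {a b R : ℝ} (h1 : α < a) (hab : a < b) (h2 : b < β)
    (hR : R < L) {u : ℂ} {V : F}
    (ha : ∃ m > (0 : ℝ), ∀ x : ℝ, m ≤ ‖1 - exp (u - (x + a * I))‖)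
    (hb : ∃ m > (0 : ℝ), ∀ x : ℝ, m ≤ ‖1 - exp (u - (x + b * I))‖)
    (hrect : ∀ᶠ X in atBot, rectIntegral (fun w => (1 - exp (u - w))⁻¹ • D w) X R a b = V) :
    bentTransform D L a b R u - rayTransform D L b u = V := by
  obtain ⟨m, hm, ha⟩ := ha
  obtain ⟨m', hm', hb⟩ := hb
  have hia := integrable_kernel (by fun_prop) ((h.ray h1 (hab.trans h2) measurableSet_Iic
    (Iic_subset_Iio.2 hR)).integrable hq hk) hm (ae_of_all _ ha)
  have hib := integrable_kernel (by fun_prop) ((h.ray (h1.trans hab) h2 measurableSet_Iic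
    (Iic_subset_Iio.2 hR)).integrable hq hk) hm' (ae_of_all _ hb)
  have hib' := integrable_kernel (by fun_prop) ((h.ray (h1.trans hab) h2 measurableSet_Ioo
    (Ioo_subset_Iio_self (a := R))).integrable hq hk) hm' (ae_of_all _ hb)
  obtain ⟨B, hB⟩ := h.exists_norm_le hq hk 0
  have key := halfStrip_integral_eq (f := fun w => (1 - exp (u - w))⁻¹ • D w) (R := R) (a := a)
    (b := b) (B := B) (V := V) hab.le hia hib hrect ?_
  · have e1 : Iio L = Iic R ∪ Ioo R L := (Iic_union_Ioo_eq_Iio hR).symm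
    simp only [bentTransform, rayTransform, kernelIntegral]
    rw [e1, setIntegral_union (Iic_disjoint_Ioi le_rfl |>.mono_right Ioo_subset_Ioi_self)
      measurableSet_Ioo hib hib']
    rw [intervalIntegral.integral_of_le hab.le, ← integral_smul] at key
    simp only [smul_comm I] at key
    rw [← key]
    abel
  · filter_upwards [eventually_lt_atBot L, eventually_le_atBot (u.re - 1)] with X hX hX' y hy
    have hD : ‖D (X + y * I)‖ ≤ B * Real.exp X := by
      simpa using hB (X + y * I) (by simpa using hX) (by simpa using h1.trans_le hy.1)
        (by simpa using hy.2.trans_lt h2)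
    have hker : 1 ≤ ‖1 - exp (u - (X + y * I))‖ := by
      have t1 := norm_sub_norm_le (exp (u - (X + y * I))) 1
      rw [norm_one, norm_exp, norm_sub_rev] at t1
      have t2 := Real.add_one_le_exp (u - (X + y * I)).re
      have t3 : (u - (X + y * I)).re = u.re - X := by simp
      rw [t3] at t1 t2
      linarith
    rw [norm_smul, norm_inv]
    calc _ ≤ 1 * ‖D (X + y * I)‖ := by
          gcongr
          exact inv_le_one_of_one_le₀ hker
      _ ≤ _ := by rwa [one_mul]

lemma exists_le_norm_one_sub_exp_ray {b : ℝ} {u : ℂ} (h0 : u.im ≠ b)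
    (h1 : b - 2 * Real.pi < u.im) (h2 : u.im < b + 2 * Real.pi) :
    ∃ m > (0 : ℝ), ∀ x : ℝ, m ≤ ‖1 - exp (u - (x + b * I))‖ := by
  have h3 : 0 < |u.im - b| := abs_pos.2 (sub_ne_zero.2 h0)
  have h4 : |u.im - b| < 2 * Real.pi := abs_lt.2 ⟨by linarith, by linarith⟩
  obtain ⟨m, hm, H⟩ := exists_le_norm_one_sub_exp_of_im
    (ζ := min |u.im - b| (2 * Real.pi - |u.im - b|)) (lt_min h3 (by linarith))
  refine ⟨m, hm, fun x => ?_⟩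
  have e : (u - (x + b * I)).im = u.im - b := by simp
  refine H _ ?_ ?_ <;> rw [e]
  · exact min_le_left _ _
  · linarith [min_le_right |u.im - b| (2 * Real.pi - |u.im - b|)]

variable [CompleteSpace F]

lemma IsFlatOnStrip.bentTransform_eq_of_inside (hq : 1 < q) (hk : 0 < k)
    (h : IsFlatOnStrip q k L α β D) {a b R : ℝ} (h1 : α < a) (hab : a < b) (h2 : b < β)
    (hab' : b - a < 2 * Real.pi) (hR : R < L) {u : ℂ} (hu : u.re < R) (hua : a < u.im)
    (hub : u.im < b) :
    bentTransform D L a b R u = rayTransform D L b u + (2 * Real.pi * I) • D u := by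
  rw [← sub_eq_iff_eq_add']
  refine h.bentTransform_sub_rayTransform hq hk h1 hab h2 hR
    (exists_le_norm_one_sub_exp_ray hua.ne' (by linarith) (by linarith))
    (exists_le_norm_one_sub_exp_ray hub.ne (by linarith) (by linarith)) ?_
  filter_upwards [eventually_lt_atBot u.re] with X hX
  refine rectIntegral_kernel_smul hX hu hua hub hab' (h.differentiableOn.mono fun w hw => ?_)
  rw [mem_reProdIm, uIcc_of_le (hX.trans hu).le, uIcc_of_le hab.le] at hw
  exact ⟨hw.1.2.trans_lt hR, h1.trans_le hw.2.1, hw.2.2.trans_lt h2⟩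

lemma IsFlatOnStrip.bentTransform_eq_of_outside (hq : 1 < q) (hk : 0 < k)
    (h : IsFlatOnStrip q k L α β D) {a b R : ℝ} (h1 : α < a) (hab : a < b) (h2 : b < β)
    (hR : R < L) {u : ℂ} (hub : b < u.im) (hua : u.im < a + 2 * Real.pi) :
    bentTransform D L a b R u = rayTransform D L b u := by
  rw [← sub_eq_zero]
  refine h.bentTransform_sub_rayTransform hq hk h1 hab h2 hR
    (exists_le_norm_one_sub_exp_ray (hab.trans hub).ne' (by linarith) (by linarith))
    (exists_le_norm_one_sub_exp_ray hub.ne' (by linarith) (by linarith)) ?_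
  filter_upwards [eventually_lt_atBot R] with X hX
  refine rectIntegral_eq_zero (DifferentiableOn.smul (DifferentiableOn.inv (by fun_prop)
    fun w hw => ?_) (h.differentiableOn.mono fun w hw => ?_))
  · rw [mem_reProdIm, uIcc_of_le hX.le, uIcc_of_le hab.le] at hw
    obtain ⟨m, hm, H⟩ := exists_le_norm_one_sub_exp_ray (b := w.im) (u := u)
      (by linarith [hw.2.2]) (by linarith [hw.2.2, Real.pi_pos])
      (by linarith [hw.2.1])
    have := H w.re
    rw [re_add_im] at this
    exact norm_pos_iff.1 (hm.trans_le this)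
  · rw [mem_reProdIm, uIcc_of_le hX.le, uIcc_of_le hab.le] at hw
    exact ⟨hw.1.2.trans_lt hR, h1.trans_le hw.2.1, hw.2.2.trans_lt h2⟩

/-- The value of the bent transform does not depend on the radius `e^R` of the bend. -/
lemma IsFlatOnStrip.bentTransform_congr_radius (hq : 1 < q) (hk : 0 < k)
    (h : IsFlatOnStrip q k L α β D) {a b R R' : ℝ} (h1 : α < a) (hab : a < b) (h2 : b < β)
    (hab' : b - a < 2 * Real.pi) (hR : R < L) (hR' : R' < L) {u : ℂ} (hu : u.re < R)
    (hu' : u.re < R') (hua : a < u.im) (hua' : u.im < a + 2 * Real.pi) :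
    bentTransform D L a b R u = bentTransform D L a b R' u := by
  rcases lt_trichotomy u.im b with hlt | heq | hgt
  · rw [h.bentTransform_eq_of_inside hq hk h1 hab h2 hab' hR hu hua hlt,
      h.bentTransform_eq_of_inside hq hk h1 hab h2 hab' hR' hu' hua hlt]
  · -- on the ray itself both sides are limits of their values below the ray
    have hγ : Tendsto (fun t : ℝ => u - t * I) (𝓝[>] 0) (𝓝 u) := by
      have : Continuous fun t : ℝ => u - t * I := by fun_prop
      simpa using (this.tendsto 0).mono_left nhdsWithin_le_nhds
    have c1 := (h.differentiableAt_bentTransform hq hk h1 hab h2 hR hu hua hua').continuousAt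
    have c2 := (h.differentiableAt_bentTransform hq hk h1 hab h2 hR' hu' hua hua').continuousAt
    refine tendsto_nhds_unique (c1.tendsto.comp hγ) ((c2.tendsto.comp hγ).congr' ?_)
    have hpos : (0 : ℝ) < b - a := by linarith
    filter_upwards [Ioo_mem_nhdsGT hpos] with t ht
    have him : (u - t * I).im = b - t := by simp [heq]
    have hre : (u - t * I).re = u.re := by simp
    have t1 : a < (u - t * I).im := by rw [him]; linarith [ht.2]
    have t2 : (u - t * I).im < b := by rw [him]; linarith [ht.1]
    simp only [Function.comp_apply]
    rw [h.bentTransform_eq_of_inside hq hk h1 hab h2 hab' hR (hre ▸ hu) t1 t2,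
      h.bentTransform_eq_of_inside hq hk h1 hab h2 hab' hR' (hre ▸ hu') t1 t2]
  · rw [h.bentTransform_eq_of_outside hq hk h1 hab h2 hR hgt hua',
      h.bentTransform_eq_of_outside hq hk h1 hab h2 hR' hgt hua']

/-- The Cauchy–Heine transform of a flat function `D` on a sector: on the logarithmic surface it is
holomorphic on a sector exceeding one full turn, it has a `q`-Gevrey expansion there, and its two
values at points that differ by a full turn differ by `D`. -/
theorem IsFlatOnStrip.exists_cauchyHeine (hq : 1 < q) (hk : 0 < k)
    (h : IsFlatOnStrip q k L α β D) {a b : ℝ} (h1 : α < a) (hab : a < b) (h2 : b < β)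
    (hab' : b - a ≤ Real.pi) :
    ∃ (H : ℂ → F) (c : ℕ → F),
      (∀ u : ℂ, u.re < L → a < u.im → u.im < b + 2 * Real.pi → DifferentiableAt ℂ H u) ∧
      (∀ u : ℂ, u.re < L → a < u.im → u.im < b → H u - H (u + 2 * Real.pi * I) = D u) ∧
      ∀ ρ < L, QGevreyBoundOn q k exp
        {u | u.re ≤ ρ ∧ (a + b) / 2 ≤ u.im ∧ u.im ≤ (a + b) / 2 + 2 * Real.pi} H c := by
  classical
  have hpi := Real.pi_pos
  have hab2 : b - a < 2 * Real.pi := by linarith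
  have h2π : (2 * Real.pi * I : ℂ) ≠ 0 := Complex.two_pi_I_ne_zero
  set z : ℂ := (2 * Real.pi * I)⁻¹ with hz
  set H : ℂ → F := fun u => z • (if b < u.im then rayTransform D L b u
    else bentTransform D L a b ((u.re + L) / 2) u) with hH
  have Hray (u : ℂ) (hu : b < u.im) : H u = z • rayTransform D L b u := by simp [hH, hu]
  have Hbent (R : ℝ) (hR : R < L) (u : ℂ) (hu : u.re < R) (hua : a < u.im)
      (hub : u.im < a + 2 * Real.pi) : H u = z • bentTransform D L a b R u := by
    by_cases hb : b < u.im
    · rw [Hray u hb, h.bentTransform_eq_of_outside hq hk h1 hab h2 hR hb hub]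
    · simp only [hH, if_neg hb]
      rw [h.bentTransform_congr_radius hq hk h1 hab h2 hab2 (by linarith) hR
        (by linarith) hu hua hub]
  refine ⟨H, fun n => z • rayMoment D L b n, fun u hu hua hub => ?_, fun u hu hua hub => ?_,
    fun ρ hρ => ?_⟩
  · by_cases hb : b < u.im
    · have hev : H =ᶠ[𝓝 u] fun v => z • rayTransform D L b v := by
        filter_upwards [(isOpen_lt continuous_const continuous_im).mem_nhds hb] with v hv
        exact Hray v hv
      exact ((h.differentiableAt_rayTransform hq hk (h1.trans hab) h2 hb hub).const_smul
        z).congr_of_eventuallyEq hev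
    · obtain ⟨R, huR, hR⟩ := exists_between hu
      have hub' : u.im < a + 2 * Real.pi := by linarith
      have hev : H =ᶠ[𝓝 u] fun v => z • bentTransform D L a b R v := by
        filter_upwards [(isOpen_lt continuous_const continuous_im).mem_nhds hua,
          (isOpen_lt continuous_im continuous_const).mem_nhds hub',
          (isOpen_lt continuous_re continuous_const).mem_nhds huR] with v hv1 hv2 hv3
        exact Hbent R hR v hv3 hv1 hv2
      exact ((h.differentiableAt_bentTransform hq hk h1 hab h2 hR huR hua hub').const_smul
        z).congr_of_eventuallyEq hev
  · obtain ⟨R, huR, hR⟩ := exists_between hu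
    have him : (u + 2 * Real.pi * I).im = u.im + 2 * Real.pi := by simp
    rw [Hbent R hR u huR hua (by linarith), Hray _ (by rw [him]; linarith),
      rayTransform_add_two_pi, h.bentTransform_eq_of_inside hq hk h1 hab h2 hab2 hR huR hua hub,
      ← smul_sub, add_sub_cancel_left, smul_smul, hz, inv_mul_cancel₀ h2π, one_smul]
  · obtain ⟨R, hρR, hR⟩ := exists_between hρ
    have hζ : 0 < (b - a) / 2 := by linarith
    have B1 := ((h.qGevreyBoundOn_bentTransform hq hk h1 hab h2 hR hρR hζ).const_smul hq z).congr
      (g := H) fun u hu => (Hbent R hR u (hu.1.trans_lt hρR) (by linarith [hu.2.1])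
        (by linarith [hu.2.2])).symm
    have B2 := ((h.qGevreyBoundOn_rayTransform hq hk (h1.trans hab) h2 hζ).const_smul hq z).congr
      (g := H) fun u hu => (Hray u (by linarith [hu.1])).symm
    refine (B1.union hq B2).mono fun u hu => ?_
    by_cases hcase : u.im ≤ a + 2 * Real.pi - (b - a) / 2
    · exact Or.inl ⟨hu.1, by linarith [hu.2.1], hcase⟩
    · exact Or.inr ⟨by linarith, by linarith [hu.2.2]⟩

end CauchyHeineJump

/-! ### Solving a flat cocycle on a covering by sectors -/

section Covering

/-- A covering of the punctured disc of radius `ε₀` by open sets that are radial in this disc; the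
sectors of a good covering are the example in view. -/
structure IsRadialCovering {ι : Type*} (ε₀ : ℝ) (E : ι → Set ℂ) : Prop where
  pos : 0 < ε₀
  isOpen : ∀ p, IsOpen (E p)
  ne_zero : ∀ p, ∀ ε ∈ E p, ε ≠ 0
  norm_lt : ∀ p, ∀ ε ∈ E p, ‖ε‖ < ε₀
  radial : ∀ p, ∀ ε ∈ E p, ∀ t : ℝ, 0 < t → t * ‖ε‖ < ε₀ → (t : ℂ) * ε ∈ E p
  cover : ∀ ε : ℂ, ε ≠ 0 → ‖ε‖ < ε₀ → ∃ p, ε ∈ E p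

variable {ι : Type*} {ε₀ : ℝ} {E : ι → Set ℂ}

/-- The circle of directions is cut into `m` arcs of equal length, each well inside one of the
covering sets (Lebesgue number). The arcs are indexed by `ℤ`, with period `m`, so that they can be
followed on the logarithmic surface. -/
lemma IsRadialCovering.exists_subdivision (hE : IsRadialCovering ε₀ E) :
    ∃ m : ℕ, 2 ≤ m ∧ ∃ τ : ℤ → ι, Function.Periodic τ m ∧ ∀ (i : ℤ) (u : ℂ),
      u.re < Real.log ε₀ → 2 * Real.pi / m * (i - 1) < u.im → u.im < 2 * Real.pi / m * (i + 2) →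
      Complex.exp u ∈ E (τ i) := by
  have hpi := Real.pi_pos
  set x₀ : ℝ := Real.log ε₀ - 1 with hx₀
  have hx₀' : Real.exp x₀ < ε₀ := by
    rw [← Real.lt_log_iff_exp_lt hE.pos]; linarith
  obtain ⟨δ, hδ, hleb⟩ := lebesgue_number_lemma_of_metric (isCompact_Icc (a := (0 : ℝ))
    (b := 2 * Real.pi)) (c := fun p => {θ : ℝ | Complex.exp (x₀ + θ * Complex.I) ∈ E p})
    (fun p => (hE.isOpen p).preimage (by fun_prop)) (fun θ _ => by
      obtain ⟨p, hp⟩ := hE.cover (Complex.exp (x₀ + θ * Complex.I)) (Complex.exp_ne_zero _)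
        (by rw [Complex.norm_exp]; simpa using hx₀')
      exact mem_iUnion.2 ⟨p, hp⟩)
  obtain ⟨p₀, -⟩ := hE.cover (Complex.exp x₀) (Complex.exp_ne_zero _)
    (by rw [Complex.norm_exp]; simpa using hx₀')
  have : Nonempty ι := ⟨p₀⟩
  choose! τ₀ hτ₀ using hleb
  obtain ⟨n, hn⟩ := exists_nat_gt (4 * Real.pi / δ)
  set m : ℕ := n + 2 with hm
  have hm0 : (0 : ℝ) < m := by positivity
  have hmδ : 2 * (2 * Real.pi / m) ≤ δ := by
    have h1 : 4 * Real.pi / δ < m := by rw [hm]; push_cast; linarith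
    rw [div_lt_iff₀ hδ] at h1
    rw [← mul_div_assoc, div_le_iff₀ hm0]
    linarith
  have hmZ : (m : ℤ) ≠ 0 := by positivity
  refine ⟨m, by omega, fun i => τ₀ (2 * Real.pi / m * (i % m : ℤ)), fun i => ?_,
    fun i u hre h1 h2 => ?_⟩
  · simp
  · have hmod0 : (0 : ℝ) ≤ ((i % m : ℤ) : ℝ) := by exact_mod_cast Int.emod_nonneg i hmZ
    have hmod1 : ((i % m : ℤ) : ℝ) ≤ m := by
      exact_mod_cast (Int.emod_lt_of_pos i (by positivity)).le
    have hs : 0 < 2 * Real.pi / m := by positivity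
    have hsm : 2 * Real.pi / m * m = 2 * Real.pi := by field_simp
    have hi : (i : ℝ) = (i % m : ℤ) + m * (i / m : ℤ) := by
      exact_mod_cast (Int.emod_add_mul_ediv i m).symm
    have hmem := hτ₀ (2 * Real.pi / m * (i % m : ℤ)) ⟨by positivity, by
      exact (mul_le_mul_of_nonneg_left hmod1 hs.le).trans_eq hsm⟩
    have hball : u.im - 2 * Real.pi * (i / m : ℤ) ∈
        Metric.ball (2 * Real.pi / m * (i % m : ℤ)) δ := by
      have e1 : 2 * Real.pi / m * i =
          2 * Real.pi / m * (i % m : ℤ) + 2 * Real.pi * (i / m : ℤ) := by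
        linear_combination 2 * Real.pi / m * hi + (i / m : ℤ) * hsm
      rw [Metric.mem_ball, Real.dist_eq, abs_lt]
      constructor <;> nlinarith
    have h3 := hE.radial _ _ (hmem hball) (Real.exp (u.re - x₀)) (Real.exp_pos _) (by
      rw [Complex.norm_exp, ← Real.exp_add, ← Real.lt_log_iff_exp_lt hE.pos]
      simpa using hre)
    convert h3 using 1
    rw [Complex.ofReal_exp, ← Complex.exp_add, Complex.exp_eq_exp_iff_exists_int]
    refine ⟨i / m, ?_⟩
    apply Complex.ext <;> simp
    ring

/-- A function is holomorphic at `e^u` if it is so in the logarithmic variable. -/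
lemma differentiableAt_of_comp_exp {F : Type*} [NormedAddCommGroup F] [NormedSpace ℂ F]
    {f : ℂ → F} {u : ℂ} (h : DifferentiableAt ℂ (fun v => f (Complex.exp v)) u) :
    DifferentiableAt ℂ f (Complex.exp u) := by
  have hne := Complex.exp_ne_zero u
  have hlog : DifferentiableAt ℂ (fun z => u + Complex.log (z / Complex.exp u)) (Complex.exp u) :=
    (DifferentiableAt.clog (by fun_prop) (by simp)).const_add u
  have h' : DifferentiableAt ℂ (fun v => f (Complex.exp v))
      (u + Complex.log (Complex.exp u / Complex.exp u)) := by simpa [div_self hne] using h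
  have hc := DifferentiableAt.comp (Complex.exp u) h' hlog
  refine hc.congr_of_eventuallyEq ?_
  filter_upwards [isOpen_ne.mem_nhds hne] with z hz
  simp only [Function.comp_apply]
  rw [Complex.exp_add, Complex.exp_log (div_ne_zero hz hne), mul_div_cancel₀ _ hne]

lemma norm_exp_rpow_mul_exp {q k K M : ℝ} (w : ℂ) :
    K * ‖Complex.exp w‖ ^ M * Real.exp (-(k / (2 * Real.log q)) * Real.log ‖Complex.exp w‖ ^ 2) =
      K * Real.exp (M * w.re - flatRate q k * w.re ^ 2) := by
  rw [Complex.norm_exp, Real.log_exp, ← Real.exp_mul, mul_assoc, ← Real.exp_add, flatRate]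
  congr 2
  ring

variable {F : Type*} [NormedAddCommGroup F] [NormedSpace ℂ F] [CompleteSpace F] {q k : ℝ}

/-- The Cauchy–Heine transforms of a periodic family of jumps `D i`, the `i`-th one flat on a strip
around `Im u = s i`, chosen so that a shift of the index by the period `m` amounts to a full
turn. -/
lemma exists_periodic_cauchyHeine (hq : 1 < q) (hk : 0 < k) {m : ℕ} (hm : 2 ≤ m) {L s : ℝ}
    (hs : s = 2 * Real.pi / m) {D : ℤ → ℂ → F}
    (hDper : ∀ i n : ℤ, ∀ u, D (i - m * n) (u - n * (2 * Real.pi * Complex.I)) = D i u)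
    (hD : ∀ i : ℤ, IsFlatOnStrip q k L (s * (i - 1)) (s * (i + 1)) (D i)) :
    ∃ (h : ℤ → ℂ → F) (c : ℤ → ℕ → F),
      (∀ i u, h (i + m) (u + 2 * Real.pi * Complex.I) = h i u) ∧ (∀ i, c (i + m) = c i) ∧
      (∀ (i : ℤ) (u : ℂ), u.re < L → s * (i - 1 / 2) < u.im →
        u.im < s * (i + 1 / 2) + 2 * Real.pi → DifferentiableAt ℂ (h i) u) ∧
      (∀ (i : ℤ) (u : ℂ), u.re < L → s * (i - 1 / 2) < u.im → u.im < s * (i + 1 / 2) →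
        h i u - h i (u + 2 * Real.pi * Complex.I) = D i u) ∧
      ∀ i : ℤ, ∀ ρ < L, QGevreyBoundOn q k Complex.exp
        {u | u.re ≤ ρ ∧ s * i ≤ u.im ∧ u.im ≤ s * i + 2 * Real.pi} (h i) (c i) := by
  have hpi := Real.pi_pos
  have hm0 : (0 : ℝ) < m := by positivity
  have hs0 : 0 < s := by rw [hs]; positivity
  have hsm : s * m = 2 * Real.pi := by rw [hs]; field_simp
  have hsπ : s ≤ Real.pi := by
    have : (2 : ℝ) ≤ m := by exact_mod_cast hm
    nlinarith
  choose h c h1 h2 h3 using fun i : ℤ => (hD i).exists_cauchyHeine hq hk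
    (a := s * (i - 1 / 2)) (b := s * (i + 1 / 2)) (by nlinarith) (by nlinarith) (by nlinarith)
    (by nlinarith)
  have hmod (i : ℤ) : s * i = s * (i % m : ℤ) + (i / m : ℤ) * (2 * Real.pi) := by
    have : (i : ℝ) = (i % m : ℤ) + m * (i / m : ℤ) := by
      exact_mod_cast (Int.emod_add_mul_ediv i m).symm
    linear_combination s * this + (i / m : ℤ) * hsm
  have hmZ : (m : ℤ) ≠ 0 := by positivity
  have him (u : ℂ) (n : ℤ) : (u - n * (2 * Real.pi * Complex.I)).im = u.im - n * (2 * Real.pi) := by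
    simp
  have hre (u : ℂ) (n : ℤ) : (u - n * (2 * Real.pi * Complex.I)).re = u.re := by simp
  refine ⟨fun i u => h (i % m) (u - (i / m : ℤ) * (2 * Real.pi * Complex.I)), fun i => c (i % m),
    fun i u => ?_, fun i => ?_, fun i u hu hu1 hu2 => ?_, fun i u hu hu1 hu2 => ?_,
    fun i ρ hρ => ?_⟩
  · simp only [Int.add_emod_right, Int.add_ediv_of_dvd_right (dvd_refl (m : ℤ)), Int.ediv_self hmZ]
    congr 1
    push_cast
    ring
  · simp
  · have e := hmod i
    have hd := h1 (i % m) (u - (i / m : ℤ) * (2 * Real.pi * Complex.I)) (by rwa [hre])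
      (by rw [him]; linarith) (by rw [him]; linarith)
    exact DifferentiableAt.comp (f := fun u : ℂ => u - (i / m : ℤ) * (2 * Real.pi * Complex.I)) u hd
      (by fun_prop)
  · have e := hmod i
    have hd := h2 (i % m) (u - (i / m : ℤ) * (2 * Real.pi * Complex.I)) (by rwa [hre])
      (by rw [him]; linarith) (by rw [him]; linarith)
    beta_reduce
    rw [← sub_add_eq_add_sub, hd]
    have : i % m = i - m * (i / m) := Int.emod_def i m
    conv_lhs => enter [1]; rw [this]
    exact hDper i (i / m) u
  · have e := hmod i
    refine QGevreyBoundOn.comp (fun u : ℂ => u - (i / m : ℤ) * (2 * Real.pi * Complex.I))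
      (h3 (i % m) ρ hρ) (fun u hu => ?_) fun u _ => ?_
    · have hu1 := hu.2.1
      have hu2 := hu.2.2
      refine ⟨by rw [hre]; exact hu.1, ?_, ?_⟩ <;> rw [him] <;> linarith
    · exact Complex.exp_periodic.sub_int_mul_eq _

end Covering

section Cocycle

variable {ι : Type*} {ε₀ : ℝ} {E : ι → Set ℂ}
  {F : Type*} [NormedAddCommGroup F] [NormedSpace ℂ F] {q k : ℝ}

lemma QGevreyBoundOn.image_exp {S : Set ℂ} {f : ℂ → F} {c : ℕ → F}
    (h : QGevreyBoundOn q k Complex.exp S (fun u => f (Complex.exp u)) c) :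
    QGevreyBoundOn q k id (Complex.exp '' S) f c := by
  obtain ⟨A, hA, C, hC, H⟩ := h
  refine ⟨A, hA, C, hC, ?_⟩
  rintro _ ⟨u, hu, rfl⟩ N
  exact H u hu N

/-- Solution of a flat jump problem on the arcs of a subdivision of the circle. The solution `Fs i`
on the `i`-th arc is a sum of Cauchy–Heine transforms, one for each of the `m` rays that separate
the arcs, evaluated on the branch of the logarithm reached from that ray without crossing it. -/
lemma exists_arcwise_solution [CompleteSpace F] (hq : 1 < q) (hk : 0 < k) {m : ℕ} (hm : 2 ≤ m)
    {L s : ℝ} (hs : s = 2 * Real.pi / m) {D : ℤ → ℂ → F}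
    (hDper : ∀ i n : ℤ, ∀ u, D (i - m * n) (u - n * (2 * Real.pi * Complex.I)) = D i u)
    (hD : ∀ i : ℤ, IsFlatOnStrip q k L (s * (i - 1)) (s * (i + 1)) (D i)) :
    ∃ (Fs : ℤ → ℂ → F) (C : ℕ → F),
      (∀ i u, Fs (i + m) (u + 2 * Real.pi * Complex.I) = Fs i u) ∧
      (∀ (i : ℤ) (u : ℂ), u.re < L → s * (i - 1 / 2) < u.im → u.im < s * (i + 1 / 2) →
        Fs i u - Fs (i - 1) u = D i u) ∧
      (∀ (i : ℤ) (u : ℂ), u.re < L → s * (i - 1 / 2) < u.im → u.im < s * (i + 3 / 2) →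
        DifferentiableAt ℂ (Fs i) u) ∧
      ∀ i : ℤ, ∀ ρ < L, QGevreyBoundOn q k Complex.exp
        {u | u.re ≤ ρ ∧ s * i ≤ u.im ∧ u.im ≤ s * (i + 1)} (Fs i) C := by
  have hpi := Real.pi_pos
  have hm0 : (0 : ℝ) < m := by positivity
  have hs0 : 0 < s := by rw [hs]; positivity
  have hsm : s * m = 2 * Real.pi := by rw [hs]; field_simp
  obtain ⟨h, c, hper, cper, hdiff, hjump, hbound⟩ :=
    exists_periodic_cauchyHeine hq hk hm hs hDper hD
  set Fs : ℤ → ℂ → F := fun i u => ∑ l ∈ Finset.Ioc (i - m) i, h l u with hFs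
  set Cs : ℤ → ℕ → F := fun i n => ∑ l ∈ Finset.Ioc (i - m) i, c l n with hCs
  have hIoc (i : ℤ) {β : Type _} [AddCommGroup β] (f : ℤ → β) :
      ∑ l ∈ Finset.Ioc (i - m) i, f l + f (i - m) =
        ∑ l ∈ Finset.Ioc (i - 1 - m) (i - 1), f l + f i := by
    have e1 : Finset.Ioc (i - 1 - m) i = insert (i - m) (Finset.Ioc (i - m) i) := by
      ext x; simp only [Finset.mem_insert, Finset.mem_Ioc]; omega
    have e2 : Finset.Ioc (i - 1 - m) i = insert i (Finset.Ioc (i - 1 - m) (i - 1)) := by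
      ext x; simp only [Finset.mem_insert, Finset.mem_Ioc]; omega
    have s1 := Finset.sum_insert (f := f) (s := Finset.Ioc (i - m) i) (a := i - m) (by simp)
    have s2 := Finset.sum_insert (f := f) (s := Finset.Ioc (i - 1 - m) (i - 1)) (a := i) (by simp)
    rw [add_comm, ← s1, ← e1, e2, s2, add_comm]
  have hFper (i : ℤ) (u : ℂ) : Fs (i + m) (u + 2 * Real.pi * Complex.I) = Fs i u := by
    simp only [hFs, add_sub_right_comm]
    rw [← Finset.image_add_right_Ioc, Finset.sum_image (by simp)]
    exact Finset.sum_congr rfl fun l _ => hper l u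
  have hCs' (i : ℤ) : Cs i = Cs 0 := by
    have step (i : ℤ) : Cs i = Cs (i - 1) := by
      ext n
      have := hIoc i (fun l => c l n)
      rw [← cper (i - m), sub_add_cancel] at this
      exact add_right_cancel this
    induction i using Int.induction_on with
    | zero => rfl
    | succ i ih => rw [step, add_sub_cancel_right, ih]
    | pred i ih => rw [← step, ih]
  have hFjump (i : ℤ) (u : ℂ) (hu : u.re < L) (h1 : s * (i - 1 / 2) < u.im)
      (h2 : u.im < s * (i + 1 / 2)) : Fs i u - Fs (i - 1) u = D i u := by
    have e := hIoc i (fun l => h l u)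
    rw [← hjump i u hu h1 h2]
    have : h i (u + 2 * Real.pi * Complex.I) = h (i - m) u := by
      rw [← hper (i - m) u, sub_add_cancel]
    rw [this, sub_eq_sub_iff_add_eq_add]
    simp only [hFs]
    rw [e, add_comm]
  have hFdiff (i : ℤ) (u : ℂ) (hu : u.re < L) (h1 : s * (i - 1 / 2) < u.im)
      (h2 : u.im < s * (i + 3 / 2)) : DifferentiableAt ℂ (Fs i) u := by
    refine DifferentiableAt.fun_sum fun l hl => ?_
    rw [Finset.mem_Ioc] at hl
    have l1 : (l : ℝ) ≤ i := by exact_mod_cast hl.2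
    have l2 : (i : ℝ) - m + 1 ≤ l := by exact_mod_cast hl.1
    have m1 := mul_le_mul_of_nonneg_left l1 hs0.le
    have m2 := mul_le_mul_of_nonneg_left l2 hs0.le
    exact hdiff l u hu (by linarith) (by linarith)
  have hFbound (i : ℤ) (ρ : ℝ) (hρ : ρ < L) : QGevreyBoundOn q k Complex.exp
      {u | u.re ≤ ρ ∧ s * i ≤ u.im ∧ u.im ≤ s * (i + 1)} (Fs i) (Cs 0) := by
    rw [← hCs' i]
    refine QGevreyBoundOn.sum hq _ fun l hl => (hbound l ρ hρ).mono fun u hu => ?_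
    rw [Finset.mem_Ioc] at hl
    have l1 : (l : ℝ) ≤ i := by exact_mod_cast hl.2
    have l2 : (i : ℝ) - m + 1 ≤ l := by exact_mod_cast hl.1
    have m1 := mul_le_mul_of_nonneg_left l1 hs0.le
    have m2 := mul_le_mul_of_nonneg_left l2 hs0.le
    have u1 := hu.2.1
    have u2 := hu.2.2
    exact ⟨hu.1, by linarith, by linarith⟩
  exact ⟨Fs, Cs 0, hFper, hFjump, hFdiff, hFbound⟩

/-- A `q`-exponentially flat additive cocycle `g` on a radial covering is a coboundary of
holomorphic functions `H p`, and these can be chosen to share a `q`-Gevrey expansion. The circle of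
directions is subdivided into arcs, the `i`-th one well inside `E (τ i)`; the jump problem with data
`g (τ (i - 1)) (τ i)` has a solution `Fs i`, and `H p = Fs i + g (τ i) p` on the `i`-th arc. -/
theorem IsRadialCovering.exists_cocycle_solution [CompleteSpace F] (hE : IsRadialCovering ε₀ E)
    (hq : 1 < q) (hk : 0 < k) {g : ι → ι → ℂ → F}
    (hg : ∀ j l, DifferentiableOn ℂ (g j l) (E j ∩ E l))
    (hflat : ∀ j l, IsQExpFlat q k (E j ∩ E l) (g j l))
    (hcoc : ∀ i j l, ∀ ε ∈ E i, ε ∈ E j → ε ∈ E l → g i j ε + g j l ε = g i l ε) :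
    ∃ (H : ι → ℂ → F) (c : ℕ → F), (∀ p, DifferentiableOn ℂ (H p) (E p)) ∧
      (∀ j l, ∀ ε ∈ E j, ε ∈ E l → H l ε - H j ε = g j l ε) ∧
      ∀ p, ∀ r < ε₀, QGevreyBoundOn q k id (E p ∩ Metric.ball 0 r) (H p) c := by
  have hpi := Real.pi_pos
  obtain ⟨m, hm, τ, hτ, hsub⟩ := hE.exists_subdivision
  have hm0 : (0 : ℝ) < m := by positivity
  set s : ℝ := 2 * Real.pi / m with hs
  have hs0 : 0 < s := by positivity
  have hsm : s * m = 2 * Real.pi := by rw [hs]; field_simp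
  set L : ℝ := Real.log ε₀ with hL
  have hexp_per (u : ℂ) (n : ℤ) :
      Complex.exp (u - n * (2 * Real.pi * Complex.I)) = Complex.exp u :=
    Complex.exp_periodic.sub_int_mul_eq n
  have hτn (i n : ℤ) : τ (i - m * n) = τ i := by
    rw [mul_comm]; exact hτ.sub_int_mul_eq n
  set D : ℤ → ℂ → F := fun i u => g (τ (i - 1)) (τ i) (Complex.exp u) with hDdef
  have hD (i : ℤ) : IsFlatOnStrip q k L (s * (i - 1)) (s * (i + 1)) (D i) := by
    have hmaps : MapsTo Complex.exp {w | w.re < L ∧ s * (i - 1) < w.im ∧ w.im < s * (i + 1)}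
        (E (τ (i - 1)) ∩ E (τ i)) := by
      intro w hw
      have h1 := hw.2.1
      have h2 := hw.2.2
      refine ⟨hsub (i - 1) w hw.1 ?_ ?_, hsub i w hw.1 ?_ ?_⟩ <;> push_cast <;> nlinarith
    refine ⟨(hg _ _).comp (by fun_prop) hmaps, ?_⟩
    obtain ⟨K, -, M, hb⟩ := hflat (τ (i - 1)) (τ i)
    refine ⟨K, M, fun w h1 h2 h3 => (hb _ (hmaps ⟨h1, h2, h3⟩)).trans_eq ?_⟩
    exact norm_exp_rpow_mul_exp w
  obtain ⟨Fs, C, hFper, hFjump, hFdiff, hFbound⟩ := exists_arcwise_solution hq hk hm hs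
    (D := D) (fun i n u => by
      have e : i - m * n - 1 = i - 1 - m * n := by ring
      simp only [hDdef, hexp_per, hτn, e]) hD
  -- the function `H p` in the logarithmic variable, as seen from the `j`-th arc
  set Φ : ι → ℤ → ℂ → F := fun p j u => Fs j u + g (τ j) p (Complex.exp u) with hΦ
  have hmem (j : ℤ) (u : ℂ) (hu : u.re < L) (h1 : s * (j - 1 / 2) < u.im)
      (h2 : u.im < s * (j + 3 / 2)) : Complex.exp u ∈ E (τ j) :=
    hsub j u hu (by linarith) (by linarith)
  have hΦper (p : ι) (j n : ℤ) (u : ℂ) :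
      Φ p (j + m * n) (u + n * (2 * Real.pi * Complex.I)) = Φ p j u := by
    have hstep (j : ℤ) (u : ℂ) : Φ p (j + m) (u + 2 * Real.pi * Complex.I) = Φ p j u := by
      simp only [hΦ]
      rw [hFper, hτ j, Complex.exp_periodic u]
    induction n using Int.induction_on generalizing j u with
    | zero => simp
    | succ n ih =>
      rw [← ih j u, ← hstep (j + m * n)]
      congr 1 <;> push_cast <;> ring
    | pred n ih =>
      rw [← ih j u, ← hstep (j + m * (-n - 1))]
      congr 1 <;> push_cast <;> ring
  have hΦstep (p : ι) (j : ℤ) (u : ℂ) (hu : u.re < L) (h1 : s * (j - 1 / 2) < u.im)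
      (h2 : u.im < s * (j + 1 / 2)) (hp : Complex.exp u ∈ E p) : Φ p j u = Φ p (j - 1) u := by
    have e1 := hFjump j u hu h1 h2
    have e2 := hcoc (τ (j - 1)) (τ j) p (Complex.exp u)
      (hmem (j - 1) u hu (by push_cast; linarith) (by push_cast; linarith))
      (hmem j u hu h1 (by linarith)) hp
    simp only [hΦ]
    rw [sub_eq_iff_eq_add'] at e1
    rw [e1, add_assoc, e2]
  have hΦcongr (p : ι) (i j : ℤ) (u : ℂ) (hu : u.re < L) (hp : Complex.exp u ∈ E p)
      (i1 : s * (i - 1 / 2) < u.im) (i2 : u.im < s * (i + 3 / 2))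
      (j1 : s * (j - 1 / 2) < u.im) (j2 : u.im < s * (j + 3 / 2)) : Φ p i u = Φ p j u := by
    have a1 : (i : ℝ) < j + 2 := lt_of_mul_lt_mul_left (by linarith) hs0.le
    have a2 : (j : ℝ) < i + 2 := lt_of_mul_lt_mul_left (by linarith) hs0.le
    have b1 : i < j + 2 := by exact_mod_cast a1
    have b2 : j < i + 2 := by exact_mod_cast a2
    obtain h0 | h0 | h0 : i = j ∨ i = j + 1 ∨ i = j - 1 := by omega
    · rw [h0]
    · have : j = i - 1 := by omega
      subst this
      push_cast at j2
      exact hΦstep p i u hu i1 (by linarith) hp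
    · subst h0
      push_cast at i2
      exact (hΦstep p j u hu j1 (by linarith) hp).symm
  set H : ι → ℂ → F := fun p ε => Φ p ⌊(Complex.log ε).im / s⌋ (Complex.log ε) with hH
  have hfloor (u : ℂ) : s * (⌊u.im / s⌋ : ℤ) ≤ u.im ∧ u.im < s * ((⌊u.im / s⌋ : ℤ) + 1) := by
    have h1 := Int.floor_le (u.im / s)
    have h2 := Int.lt_floor_add_one (u.im / s)
    rw [le_div_iff₀ hs0] at h1
    rw [div_lt_iff₀ hs0] at h2
    constructor <;> linarith
  have hkey (p : ι) (j : ℤ) (u : ℂ) (hu : u.re < L) (hp : Complex.exp u ∈ E p)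
      (h1 : s * (j - 1 / 2) < u.im) (h2 : u.im < s * (j + 3 / 2)) :
      H p (Complex.exp u) = Φ p j u := by
    simp only [hH]
    set v := Complex.log (Complex.exp u) with hv
    have hexp : Complex.exp u = Complex.exp v := (Complex.exp_log (Complex.exp_ne_zero u)).symm
    obtain ⟨n, hn⟩ := Complex.exp_eq_exp_iff_exists_int.1 hexp
    obtain ⟨f1, f2⟩ := hfloor v
    have him : u.im = v.im + n * (2 * Real.pi) := by simpa using congrArg Complex.im hn
    rw [← hΦper p _ n v, ← hn]
    refine hΦcongr p _ j u hu hp ?_ ?_ h1 h2 <;> push_cast <;> rw [him, ← hsm] <;> linarith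
  have hre (p : ι) (u : ℂ) (hp : Complex.exp u ∈ E p) : u.re < L := by
    have := hE.norm_lt p _ hp
    rw [Complex.norm_exp] at this
    rwa [hL, Real.lt_log_iff_exp_lt hE.pos]
  refine ⟨H, C, fun p ε hε => ?_, fun j l ε hj hl => ?_, fun p r hr => ?_⟩
  · have hε0 := hE.ne_zero p ε hε
    obtain ⟨u, rfl⟩ : ∃ u, Complex.exp u = ε := ⟨_, Complex.exp_log hε0⟩
    obtain ⟨f1, f2⟩ := hfloor u
    set j := ⌊u.im / s⌋
    have hu := hre p u hε
    have h1 : s * (j - 1 / 2) < u.im := by linarith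
    have h2 : u.im < s * (j + 3 / 2) := by linarith
    refine (differentiableAt_of_comp_exp ?_).differentiableWithinAt
    have hΦd : DifferentiableAt ℂ (Φ p j) u := by
      refine (hFdiff j u hu h1 h2).add ?_
      have hmem' := hmem j u hu h1 h2
      exact ((hg (τ j) p).differentiableAt (((hE.isOpen _).inter (hE.isOpen _)).mem_nhds
        ⟨hmem', hε⟩)).comp u (by fun_prop)
    refine hΦd.congr_of_eventuallyEq ?_
    filter_upwards [((hE.isOpen p).preimage Complex.continuous_exp).mem_nhds hε,
      (isOpen_lt continuous_const Complex.continuous_im).mem_nhds h1,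
      (isOpen_lt Complex.continuous_im continuous_const).mem_nhds h2] with v v0 v1 v2
    exact hkey p j v (hre p v v0) v0 v1 v2
  · obtain ⟨u, rfl⟩ : ∃ u, Complex.exp u = ε := ⟨_, Complex.exp_log (hE.ne_zero j ε hj)⟩
    obtain ⟨f1, f2⟩ := hfloor u
    have hu := hre j u hj
    have h1 : s * ((⌊u.im / s⌋ : ℤ) - 1 / 2) < u.im := by linarith
    have h2 : u.im < s * ((⌊u.im / s⌋ : ℤ) + 3 / 2) := by linarith
    rw [hkey l _ u hu hl h1 h2, hkey j _ u hu hj h1 h2]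
    have := hcoc _ j l _ (hmem _ u hu h1 h2) hj hl
    simp only [hΦ]
    rw [← this]
    abel
  · rcases le_or_gt r 0 with hr0 | hr0
    · refine ⟨1, one_pos, 1, one_pos, fun ε hε => ?_⟩
      have := hε.2
      rw [Metric.ball_eq_empty.2 hr0] at this
      exact absurd this (notMem_empty _)
    · set T : ℤ → Set ℂ := fun i => {u | Complex.exp u ∈ E p ∧ u.re ≤ Real.log r ∧
        s * i ≤ u.im ∧ u.im ≤ s * (i + 1)} with hT
      have hρ : Real.log r < L := Real.log_lt_log hr0 hr
      have hTb (i : ℤ) : QGevreyBoundOn q k id (Complex.exp '' T i) (H p) (C) := by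
        refine QGevreyBoundOn.image_exp ?_
        have hin (u : ℂ) (hu : u ∈ T i) : s * (i - 1 / 2) < u.im ∧ u.im < s * (i + 3 / 2) := by
          have u1 := hu.2.2.1
          have u2 := hu.2.2.2
          constructor <;> linarith
        have b1 := (hFbound i (Real.log r) hρ).mono (S' := T i) fun u hu => hu.2
        have b2 : QGevreyBoundOn q k Complex.exp (T i) (fun u => g (τ i) p (Complex.exp u))
            (fun _ => 0) := by
          obtain ⟨K, -, M, hb⟩ := hflat (τ i) p
          refine QGevreyBoundOn.of_flat hq hk (K := K) (M := M)
            (fun u _ => Complex.exp_ne_zero u) fun u hu => ?_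
          have := hb _ ⟨hmem i u (hre p u hu.1) (hin u hu).1 (hin u hu).2, hu.1⟩
          rw [norm_exp_rpow_mul_exp] at this
          rwa [Complex.norm_exp, Real.log_exp]
        have b3 := b1.add hq b2
        simp only [add_zero] at b3
        exact b3.congr fun u hu => (hkey p i u (hre p u hu.1) hu.1 (hin u hu).1 (hin u hu).2).symm
      refine (QGevreyBoundOn.biUnion hq (Finset.Icc (-(m : ℤ)) m) fun i _ => hTb i).mono ?_
      intro ε hε
      have hε0 := hE.ne_zero p ε hε.1
      have hexp := Complex.exp_log hε0
      obtain ⟨f1, f2⟩ := hfloor (Complex.log ε)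
      have a1 := Complex.neg_pi_lt_log_im ε
      have a2 := Complex.log_im_le_pi ε
      refine mem_iUnion₂.2 ⟨⌊(Complex.log ε).im / s⌋, ?_, Complex.log ε,
        ⟨by rw [hexp]; exact hε.1, ?_, f1, f2.le⟩, hexp⟩
      · have c1 : (-(m : ℝ) - 1) < (⌊(Complex.log ε).im / s⌋ : ℤ) :=
          lt_of_mul_lt_mul_left (by linarith) hs0.le
        have c2 : ((⌊(Complex.log ε).im / s⌋ : ℤ) : ℝ) < m + 1 :=
          lt_of_mul_lt_mul_left (by linarith) hs0.le
        have d1 : (-(m : ℤ) - 1) < ⌊(Complex.log ε).im / s⌋ := by exact_mod_cast c1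
        have d2 : ⌊(Complex.log ε).im / s⌋ < (m : ℤ) + 1 := by exact_mod_cast c2
        rw [Finset.mem_Icc]
        omega
      · rw [Complex.log_re]
        exact Real.log_le_log (norm_pos_iff.2 hε0) (mem_ball_zero_iff.1 hε.2).le

end Cocycle

/-! ### Sectors and good coverings -/

lemma openSector_eq_image_exp {d δ r : ℝ} (hr : 0 < r) : openSector d δ r =
    Complex.exp '' {u | u.re < Real.log r ∧ |u.im - d| < δ / 2} := by
  ext z
  constructor
  · rintro ⟨s, θ, hs, hsr, hθ, rfl⟩
    refine ⟨Real.log s + θ * Complex.I, ⟨?_, ?_⟩, ?_⟩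
    · simpa using Real.log_lt_log hs hsr
    · simpa using hθ
    · rw [Complex.exp_add, ← Complex.ofReal_exp, Real.exp_log hs]
  · rintro ⟨u, ⟨h1, h2⟩, rfl⟩
    refine ⟨Real.exp u.re, u.im, Real.exp_pos _, (Real.lt_log_iff_exp_lt hr).1 h1, h2, ?_⟩
    rw [Complex.ofReal_exp, ← Complex.exp_add, Complex.re_add_im]

lemma isOpen_openSector {d δ r : ℝ} (hr : 0 < r) : IsOpen (openSector d δ r) := by
  rw [openSector_eq_image_exp hr]
  refine Complex.isOpenMap_exp _ ?_
  exact (isOpen_lt Complex.continuous_re continuous_const).inter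
    (isOpen_lt (Complex.continuous_im.sub continuous_const).abs continuous_const)

lemma norm_ofReal_mul_exp_I {s θ : ℝ} (hs : 0 < s) :
    ‖(s : ℂ) * Complex.exp (θ * Complex.I)‖ = s := by
  rw [norm_mul, Complex.norm_exp_ofReal_mul_I, mul_one, Complex.norm_real,
    Real.norm_of_nonneg hs.le]

lemma norm_lt_of_mem_openSector {d δ r : ℝ} {z : ℂ} (hz : z ∈ openSector d δ r) : ‖z‖ < r := by
  obtain ⟨s, θ, hs, hsr, -, rfl⟩ := hz
  rwa [norm_ofReal_mul_exp_I hs]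

lemma ne_zero_of_mem_openSector {d δ r : ℝ} {z : ℂ} (hz : z ∈ openSector d δ r) : z ≠ 0 := by
  obtain ⟨s, θ, hs, -, -, rfl⟩ := hz
  rw [← norm_pos_iff, norm_ofReal_mul_exp_I hs]
  exact hs

lemma IsGoodCovering.isRadialCovering {ς : ℕ} {ε₀ : ℝ} {E : ZMod ς → Set ℂ}
    (hE : IsGoodCovering ς ε₀ E) : IsRadialCovering ε₀ E := by
  have hpos : 0 < ε₀ := (hE.sector 0).1
  have hradial : ∀ p, ∀ ε ∈ E p, ∀ t : ℝ, 0 < t → t * ‖ε‖ < ε₀ → (t : ℂ) * ε ∈ E p := by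
    intro p ε hε t ht hlt
    obtain ⟨-, d, δ, -, -, hS⟩ := hE.sector p
    rw [hS] at hε ⊢
    obtain ⟨s, θ, hs, hsr, hθ, rfl⟩ := hε
    rw [norm_ofReal_mul_exp_I hs] at hlt
    exact ⟨t * s, θ, by positivity, hlt, hθ, by push_cast; ring⟩
  refine ⟨hpos, fun p => ?_, fun p ε hε => ?_, fun p ε hε => ?_, hradial, fun ε h0 hlt => ?_⟩
  · obtain ⟨h, d, δ, -, -, hS⟩ := hE.sector p
    rw [hS]
    exact isOpen_openSector h
  · obtain ⟨h, d, δ, -, -, hS⟩ := hE.sector p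
    exact ne_zero_of_mem_openSector (hS ▸ hε)
  · obtain ⟨h, d, δ, -, -, hS⟩ := hE.sector p
    exact norm_lt_of_mem_openSector (hS ▸ hε)
  · -- a small multiple of `ε` lies in some `E p`, which is radial
    obtain ⟨U, hU, hUE⟩ := hE.iUnion_eq
    have ht : Filter.Tendsto (fun t : ℝ => (t : ℂ) * ε) (𝓝[>] 0) (𝓝 0) := by
      have : Continuous fun t : ℝ => (t : ℂ) * ε := by fun_prop
      simpa using (this.tendsto 0).mono_left nhdsWithin_le_nhds
    obtain ⟨t, htU, ht0⟩ := ((ht.eventually_mem hU).and self_mem_nhdsWithin).exists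
    have ht0' : (0 : ℝ) < t := ht0
    have htne : (t : ℂ) ≠ 0 := by exact_mod_cast ht0'.ne'
    have hmem : (t : ℂ) * ε ∈ ⋃ p, E p := by
      rw [hUE]
      exact ⟨htU, mul_ne_zero htne h0⟩
    obtain ⟨p, hp⟩ := mem_iUnion.1 hmem
    refine ⟨p, ?_⟩
    have := hradial p _ hp t⁻¹ (by positivity) (by
      rw [norm_mul, Complex.norm_real, Real.norm_of_nonneg ht0'.le, inv_mul_cancel_left₀ ht0'.ne']
      exact hlt)
    rwa [Complex.ofReal_inv, inv_mul_cancel_left₀ htne] at this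

/-- A sector whose closure without the vertex lies in a set of points of norm less than `ε₀` has
radius less than `ε₀`. -/
lemma IsOpenSector.radius_lt {U V : Set ℂ} {r ε₀ : ℝ} (hU : IsOpenSector U r)
    (hV : ∀ ε ∈ V, ‖ε‖ < ε₀) (h : closure U \ {0} ⊆ V) : r < ε₀ := by
  obtain ⟨hr, d, δ, hδ, -, rfl⟩ := hU
  have hn := norm_ofReal_mul_exp_I (θ := d) hr
  rw [← hn]
  refine hV _ (h ⟨?_, ?_⟩)
  · have ht : Filter.Tendsto (fun s : ℝ => (s : ℂ) * Complex.exp (d * Complex.I)) (𝓝[<] r)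
        (𝓝 ((r : ℂ) * Complex.exp (d * Complex.I))) := by
      have : Continuous fun s : ℝ => (s : ℂ) * Complex.exp (d * Complex.I) := by fun_prop
      exact (this.tendsto r).mono_left nhdsWithin_le_nhds
    refine mem_closure_of_tendsto ht ?_
    filter_upwards [Ioo_mem_nhdsLT hr] with s hs
    exact ⟨s, d, hs.1, hs.2, by simpa using hδ, rfl⟩
  · rw [mem_singleton_iff, ← norm_eq_zero, hn]
    exact hr.ne'

section Flat

variable {F : Type*} [NormedAddCommGroup F] {q k : ℝ} {Z : Set ℂ} {f g : ℂ → F}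

lemma IsQExpFlat.congr (h : IsQExpFlat q k Z f) (hfg : ∀ ε ∈ Z, g ε = f ε) :
    IsQExpFlat q k Z g := by
  obtain ⟨K, hK, M, H⟩ := h
  exact ⟨K, hK, M, fun ε hε => by rw [hfg ε hε]; exact H ε hε⟩

lemma isQExpFlat_zero : IsQExpFlat q k Z (fun _ => (0 : F)) :=
  ⟨1, one_pos, 0, fun ε _ => by simp [Real.exp_nonneg]⟩

lemma IsQExpFlat.swap {G : ℂ → F} {G' : ℂ → F} {Z' : Set ℂ}
    (h : IsQExpFlat q k (Z ∩ Z') (fun ε => G ε - G' ε)) :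
    IsQExpFlat q k (Z' ∩ Z) (fun ε => G' ε - G ε) := by
  obtain ⟨K, hK, M, H⟩ := h
  exact ⟨K, hK, M, fun ε hε => by rw [norm_sub_rev]; exact H ε hε.symm⟩

lemma IsQExpFlat.mono_order {k' : ℝ} (hq : 1 < q) (h : IsQExpFlat q k' Z f) (hk : k ≤ k') :
    IsQExpFlat q k Z f := by
  obtain ⟨K, hK, M, H⟩ := h
  refine ⟨K, hK, M, fun ε hε => (H ε hε).trans ?_⟩
  have := Real.log_pos hq
  gcongr

end Flat

section Splitting

variable {F : Type*} [NormedAddCommGroup F]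

/-- The pair `{j, l}` is consecutive with index in `I₂`, and no three distinct sectors of the
covering have a common point. Three distinct indices are pairwise consecutive only when `ς = 3`,
so the last condition excludes only certain coverings by three sectors. It is needed because,
on a triple intersection, the differences over the edges of level two alone need not satisfy the
cocycle relation. -/
def IsLevelTwoEdge {ς : ℕ} (E : ZMod ς → Set ℂ) (I₂ : Set (ZMod ς)) (j l : ZMod ς) : Prop :=
  (∀ a b c : ZMod ς, a ≠ b → b ≠ c → a ≠ c → E a ∩ E b ∩ E c = ∅) ∧
    ((l = j + 1 ∧ j ∈ I₂) ∨ (j = l + 1 ∧ l ∈ I₂))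

open Classical in
/-- The part of level two of the cocycle `G l - G j`: the differences over the edges of level two,
completed by zero. -/
noncomputable def levelTwoCocycle {ς : ℕ} (E : ZMod ς → Set ℂ) (G : ZMod ς → ℂ → F)
    (I₂ : Set (ZMod ς)) (j l : ZMod ς) (ε : ℂ) : F :=
  if IsLevelTwoEdge E I₂ j l then G l ε - G j ε else 0

variable {ς : ℕ} {ε₀ : ℝ} {E : ZMod ς → Set ℂ} {G : ZMod ς → ℂ → F} {I₁ I₂ : Set (ZMod ς)}
  {q k₁ k₂ : ℝ}

lemma levelTwoCocycle_cocycle (i j l : ZMod ς) {ε : ℂ} (hi : ε ∈ E i) (hj : ε ∈ E j)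
    (hl : ε ∈ E l) : levelTwoCocycle E G I₂ i j ε + levelTwoCocycle E G I₂ j l ε =
      levelTwoCocycle E G I₂ i l ε := by
  have hself (j : ZMod ς) : levelTwoCocycle E G I₂ j j ε = 0 := by
    simp [levelTwoCocycle]
  have hsymm (j l : ZMod ς) :
      levelTwoCocycle E G I₂ j l ε + levelTwoCocycle E G I₂ l j ε = 0 := by
    have e : IsLevelTwoEdge E I₂ j l ↔ IsLevelTwoEdge E I₂ l j :=
      and_congr_right fun _ => or_comm
    by_cases h : IsLevelTwoEdge E I₂ j l
    · rw [levelTwoCocycle, levelTwoCocycle, if_pos h, if_pos (e.1 h), sub_add_sub_cancel, sub_self]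
    · rw [levelTwoCocycle, levelTwoCocycle, if_neg h, if_neg (fun h' => h (e.2 h')), add_zero]
  by_cases hT : ∀ a b c : ZMod ς, a ≠ b → b ≠ c → a ≠ c → E a ∩ E b ∩ E c = ∅
  · by_cases hij : i = j
    · rw [hij, hself, zero_add]
    by_cases hjl : j = l
    · rw [hjl, hself, add_zero]
    by_cases hil : i = l
    · rw [hil, hsymm, hself]
    exact absurd (hT i j l hij hjl hil) (nonempty_iff_ne_empty.1 ⟨ε, ⟨hi, hj⟩, hl⟩)
  · simp [levelTwoCocycle, IsLevelTwoEdge, hT]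

lemma isQExpFlat_levelTwoCocycle
    (hflat₂ : ∀ p ∈ I₂, IsQExpFlat q k₂ (E p ∩ E (p + 1)) (fun ε => G (p + 1) ε - G p ε))
    (j l : ZMod ς) : IsQExpFlat q k₂ (E j ∩ E l) (levelTwoCocycle E G I₂ j l) := by
  by_cases h : IsLevelTwoEdge E I₂ j l
  · refine IsQExpFlat.congr (f := fun ε => G l ε - G j ε) ?_ fun ε _ => if_pos h
    rcases h.2 with ⟨rfl, hj⟩ | ⟨rfl, hl⟩
    · exact hflat₂ j hj
    · exact (hflat₂ l hl).swap
  · exact isQExpFlat_zero.congr fun ε _ => if_neg h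

/-- The complementary part of the cocycle is flat of order `k₁`. -/
lemma isQExpFlat_sub_levelTwoCocycle (hE : IsGoodCovering ς ε₀ E) (hq : 1 < q) (hk : k₁ ≤ k₂)
    (hI_union : I₁ ∪ I₂ = Set.univ)
    (hflat₁ : ∀ p ∈ I₁, IsQExpFlat q k₁ (E p ∩ E (p + 1)) (fun ε => G (p + 1) ε - G p ε))
    (hflat₂ : ∀ p ∈ I₂, IsQExpFlat q k₂ (E p ∩ E (p + 1)) (fun ε => G (p + 1) ε - G p ε))
    (j l : ZMod ς) :
    IsQExpFlat q k₁ (E j ∩ E l) (fun ε => G l ε - G j ε - levelTwoCocycle E G I₂ j l ε) := by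
  have hall (p : ZMod ς) : IsQExpFlat q k₁ (E p ∩ E (p + 1)) (fun ε => G (p + 1) ε - G p ε) := by
    rcases (hI_union ▸ mem_univ p : p ∈ I₁ ∪ I₂) with hp | hp
    · exact hflat₁ p hp
    · exact (hflat₂ p hp).mono_order hq hk
  by_cases h : IsLevelTwoEdge E I₂ j l
  · exact isQExpFlat_zero.congr fun ε _ => by rw [levelTwoCocycle, if_pos h, sub_self]
  · refine IsQExpFlat.congr (f := fun ε => G l ε - G j ε) ?_ fun ε _ => by
      rw [levelTwoCocycle, if_neg h, sub_zero]
    rcases (E j ∩ E l).eq_empty_or_nonempty with he | hne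
    · exact isQExpFlat_zero.congr fun ε hε => absurd hε (he ▸ notMem_empty ε)
    · rcases (hE.inter_nonempty_iff j l).1 hne with rfl | rfl | rfl
      · exact isQExpFlat_zero.congr fun ε _ => sub_self _
      · exact hall j
      · exact (hall l).swap

end Splitting

/-! ### The two-level Ramis–Sibuya theorem -/

section RamisSibuya

variable {F : Type*} [NormedAddCommGroup F] [NormedSpace ℂ F] {q k : ℝ}

lemma HasQGevreyExpansion.of_qGevreyBoundOn {V : Set ℂ} {ε₀ : ℝ} {f : ℂ → F} {c : ℕ → F}
    (hV : ∀ ε ∈ V, ‖ε‖ < ε₀) (h : ∀ r < ε₀, QGevreyBoundOn q k id (V ∩ Metric.ball 0 r) f c) :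
    HasQGevreyExpansion q k V f c := by
  intro U r hU hUV
  refine (h r (hU.radius_lt hV hUV)).mono fun ε hε => ?_
  obtain ⟨hr, d, δ, -, -, rfl⟩ := hU
  exact ⟨hUV ⟨subset_closure hε, ne_zero_of_mem_openSector hε⟩,
    mem_ball_zero_iff.2 (norm_lt_of_mem_openSector hε)⟩

/-- A function with a `q`-Gevrey expansion is bounded near the origin. -/
lemma QGevreyBoundOn.eventually_norm_le {V : Set ℂ} {r : ℝ} (hr : 0 < r) {f : ℂ → F} {c : ℕ → F}
    (h : QGevreyBoundOn q k id (V ∩ Metric.ball 0 r) f c) :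
    ∃ B : ℝ, ∀ᶠ ε in 𝓝 (0 : ℂ), ε ∈ V → ‖f ε‖ ≤ B := by
  obtain ⟨A, hA, C, hC, H⟩ := h
  refine ⟨C * A * r + ‖c 0‖, ?_⟩
  filter_upwards [Metric.ball_mem_nhds (0 : ℂ) hr] with ε hε hV
  have h0 := H ε ⟨hV, hε⟩ 0
  simp only [zero_add, Finset.range_one, Finset.sum_singleton, pow_zero, one_smul, pow_one,
    Nat.cast_zero, zero_div, Real.rpow_zero, mul_one, id] at h0
  have h1 : ‖ε‖ < r := mem_ball_zero_iff.1 hε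
  have h2 := norm_le_norm_sub_add (f ε) (c 0)
  have h3 : C * A * ‖ε‖ ≤ C * A * r := by gcongr
  linarith

/-- Holomorphic functions on the sets of a covering that agree on the overlaps and are bounded near
the origin are the restrictions of one function holomorphic on the disc. -/
lemma IsRadialCovering.exists_differentiableOn_ball [CompleteSpace F] {ι : Type*} [Finite ι]
    {ε₀ : ℝ} {E : ι → Set ℂ} (hE : IsRadialCovering ε₀ E) {f : ι → ℂ → F}
    (hf : ∀ p, DifferentiableOn ℂ (f p) (E p))
    (hcompat : ∀ j l, ∀ ε ∈ E j, ε ∈ E l → f j ε = f l ε)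
    (hbdd : ∀ p, ∃ B : ℝ, ∀ᶠ ε in 𝓝 (0 : ℂ), ε ∈ E p → ‖f p ε‖ ≤ B) :
    ∃ a : ℂ → F, DifferentiableOn ℂ a (Metric.ball 0 ε₀) ∧ ∀ p, ∀ ε ∈ E p, a ε = f p ε := by
  classical
  set a₀ : ℂ → F := fun ε => if h : ∃ p, ε ∈ E p then f h.choose ε else 0 with ha₀
  have ha (p : ι) (ε : ℂ) (hε : ε ∈ E p) : a₀ ε = f p ε := by
    have h : ∃ p, ε ∈ E p := ⟨p, hε⟩
    simp only [ha₀, dif_pos h]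
    exact hcompat _ _ ε h.choose_spec hε
  have hcov (ε : ℂ) (hε : ε ∈ Metric.ball 0 ε₀ \ {0}) : ∃ p, ε ∈ E p :=
    hE.cover ε hε.2 (mem_ball_zero_iff.1 hε.1)
  have hd : DifferentiableOn ℂ a₀ (Metric.ball 0 ε₀ \ {0}) := by
    intro ε hε
    obtain ⟨p, hp⟩ := hcov ε hε
    have hmem := (hE.isOpen p).mem_nhds hp
    refine (((hf p).differentiableAt hmem).congr_of_eventuallyEq ?_).differentiableWithinAt
    filter_upwards [hmem] with z hz using ha p z hz
  have hball := Metric.ball_mem_nhds (0 : ℂ) hE.pos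
  have hlittle : (fun z => a₀ z - a₀ 0) =o[𝓝[≠] 0] fun z => (z - 0)⁻¹ := by
    choose B hB using hbdd
    have := Fintype.ofFinite ι
    refine Filter.IsBoundedUnder.isLittleO_sub_self_inv
      ⟨∑ p, |B p| + ‖a₀ 0‖, Filter.eventually_map.2 ?_⟩
    filter_upwards [nhdsWithin_le_nhds (Filter.eventually_all.2 hB), nhdsWithin_le_nhds hball,
      self_mem_nhdsWithin] with ε h1 h2 h3
    obtain ⟨p, hp⟩ := hcov ε ⟨h2, h3⟩
    refine norm_sub_le_of_le ?_ le_rfl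
    rw [ha p ε hp]
    exact (h1 p hp).trans ((le_abs_self _).trans
      (Finset.single_le_sum (f := fun p => |B p|) (fun _ _ => abs_nonneg _) (Finset.mem_univ p)))
  refine ⟨_, Complex.differentiableOn_update_limUnder_of_isLittleO hball hd hlittle,
    fun p ε hε => ?_⟩
  rw [Function.update_of_ne (hE.ne_zero p ε hε), ha p ε hε]

end RamisSibuya

theorem theorem1215 {F : Type*} [NormedAddCommGroup F] [NormedSpace ℂ F] [CompleteSpace F]
    (q : ℝ) (hq : 1 < q) (k₁ k₂ : ℝ) (hk₁ : 0 < k₁) (hk₁₂ : k₁ < k₂)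
    (ς : ℕ) (ε₀ : ℝ) (E : ZMod ς → Set ℂ) (hE : IsGoodCovering ς ε₀ E)
    (G : ZMod ς → ℂ → F)
    (hG_hol : ∀ p, DifferentiableOn ℂ (G p) (E p))
    (hG_bdd : ∀ p, ∃ r > (0 : ℝ), ∃ C : ℝ, ∀ ε ∈ E p, ‖ε‖ < r → ‖G p ε‖ ≤ C)
    (I₁ I₂ : Set (ZMod ς)) (hI₁ : I₁.Nonempty) (hI₂ : I₂.Nonempty)
    (hI_union : I₁ ∪ I₂ = Set.univ) (hI_inter : I₁ ∩ I₂ = ∅)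
    (hflat₁ : ∀ p ∈ I₁, IsQExpFlat q k₁ (E p ∩ E (p + 1)) (fun ε => G (p + 1) ε - G p ε))
    (hflat₂ : ∀ p ∈ I₂, IsQExpFlat q k₂ (E p ∩ E (p + 1)) (fun ε => G (p + 1) ε - G p ε)) :
    ∃ (α : ℕ → F) (a : ℂ → F) (c₁ c₂ : ℕ → F) (G₁ G₂ : ZMod ς → ℂ → F),
      (∀ ε ∈ Metric.ball (0 : ℂ) ε₀, HasSum (fun n => ε ^ n • α n) (a ε)) ∧
      (∀ p, ∀ ε ∈ E p, G p ε = a ε + G₁ p ε + G₂ p ε) ∧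
      (∀ p, DifferentiableOn ℂ (G₁ p) (E p) ∧ HasQGevreyExpansion q k₁ (E p) (G₁ p) c₁) ∧
      (∀ p, DifferentiableOn ℂ (G₂ p) (E p) ∧ HasQGevreyExpansion q k₂ (E p) (G₂ p) c₂) := by
  have hς : NeZero ς := ⟨by have := hE.two_le; omega⟩
  have hR := hE.isRadialCovering
  have hGsub (j l : ZMod ς) : DifferentiableOn ℂ (fun ε => G l ε - G j ε) (E j ∩ E l) :=
    ((hG_hol l).mono inter_subset_right).sub ((hG_hol j).mono inter_subset_left)
  have hg₂ (j l : ZMod ς) : DifferentiableOn ℂ (levelTwoCocycle E G I₂ j l) (E j ∩ E l) := by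
    by_cases h : IsLevelTwoEdge E I₂ j l
    · exact (hGsub j l).congr fun ε _ => if_pos h
    · exact (differentiableOn_const (0 : F)).congr fun ε _ => if_neg h
  obtain ⟨G₂, c₂, d₂, j₂, b₂⟩ := hR.exists_cocycle_solution hq (hk₁.trans hk₁₂) hg₂
    (isQExpFlat_levelTwoCocycle hflat₂)
    (fun i j l ε hi hj hl => levelTwoCocycle_cocycle i j l hi hj hl)
  obtain ⟨G₁, c₁, d₁, j₁, b₁⟩ := hR.exists_cocycle_solution hq hk₁
    (g := fun j l ε => G l ε - G j ε - levelTwoCocycle E G I₂ j l ε)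
    (fun j l => (hGsub j l).sub (hg₂ j l))
    (isQExpFlat_sub_levelTwoCocycle hE hq hk₁₂.le hI_union hflat₁ hflat₂)
    (fun i j l ε hi hj hl => by
      rw [← levelTwoCocycle_cocycle i j l hi hj hl]
      abel)
  obtain ⟨a, ha, haE⟩ := hR.exists_differentiableOn_ball (f := fun p ε => G p ε - G₁ p ε - G₂ p ε)
    (fun p => ((hG_hol p).sub (d₁ p)).sub (d₂ p))
    (fun j l ε hj hl => by
      have e₁ := j₁ j l ε hj hl
      rw [← j₂ j l ε hj hl] at e₁
      rw [← sub_eq_zero]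
      rw [← sub_eq_zero] at e₁
      rw [← e₁]
      abel)
    (fun p => by
      obtain ⟨r, hr, C, hC⟩ := hG_bdd p
      have hhalf : ε₀ / 2 < ε₀ := half_lt_self hR.pos
      obtain ⟨B₁, hB₁⟩ := (b₁ p _ hhalf).eventually_norm_le (half_pos hR.pos)
      obtain ⟨B₂, hB₂⟩ := (b₂ p _ hhalf).eventually_norm_le (half_pos hR.pos)
      refine ⟨C + B₁ + B₂, ?_⟩
      filter_upwards [hB₁, hB₂, Metric.ball_mem_nhds (0 : ℂ) hr] with ε h1 h2 h3 hε
      exact norm_sub_le_of_le (norm_sub_le_of_le (hC ε hε (mem_ball_zero_iff.1 h3)) (h1 hε))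
        (h2 hε))
  refine ⟨fun n => (n.factorial : ℂ)⁻¹ • iteratedDeriv n a 0, a, c₁, c₂, G₁, G₂, fun ε hε => ?_,
    fun p ε hε => ?_, fun p => ⟨d₁ p, .of_qGevreyBoundOn (hR.norm_lt p) (b₁ p)⟩,
    fun p => ⟨d₂ p, .of_qGevreyBoundOn (hR.norm_lt p) (b₂ p)⟩⟩
  · have := Complex.hasSum_taylorSeries_on_ball ha hε
    convert this using 1
    funext n
    rw [sub_zero, smul_comm]
  · rw [haE p ε hε]
    abel
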